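/- Let $\dot L^2_{\rm per}$ be the Hilbert space of complex-valued $2\pi$-periodic functions that are square integrable on $(-\pi,\pi)$ and have zero mean, $\int_{-\pi}^{\pi} v\,dz=0$. Let $\partial_z^{-1}:\dot L^2_{\rm per}\to\dot L^2_{\rm per}$ be the operator that maps $v$ to its zero-mean antiderivative. Let $c_*=\pi^2/9$ and let $U_*$ be the peaked traveling wave of the reduced Ostrovsky equation $u_t+uu_x=\partial_x^{-1}u$, i.e. $U_*(z)=\frac1{18}(3z^2-\pi^2)$ for $z\in[-\pi,\pi]$, continued $2\pi$-periodically. Consider the linearized operator $$A v=\partial_z\big[(c_*-U_*)v\big]+\partial_z^{-1}v,\qquad \mathrm{dom}(A)=\big\{v\in\dot L^2_{\rm per}:\ \partial_z[(c_*-U_*)v]\in\dot L^2_{\rm per}\big\},$$ in $\dot L^2_{\rm per}$, where $\partial_z$ is the derivative of periodic distributions. Let $\rho(A)$ be the set of $\lambda\in\mathbb C$ for which $A-\lambda I$ has trivial kernel and full range $\dot L^2_{\rm per}$ and $(A-\lambda I)^{-1}$ is bounded, and let $\sigma(A)=\mathbb C\setminus\rho(A)$. Then $$\sigma(A)=\Big\{\lambda\in\mathbb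 C:\ -\frac{\pi}{6}\le \mathrm{Re}\,\lambda\le\frac{\pi}{6}\Big\}.$$ Consequently, $U_*$ is spectrally unstable, i.e. $\sigma(A)\not\subset i\mathbb R$. -/

import Mathlib

open MeasureTheory Set
open scoped ContDiff

namespace Ostrovsky

noncomputable section

/-! ### The space of `2π`-periodic square integrable functions with zero mean -/

/-- `L²_per`: complex square integrable `2π`-periodic functions, identified with their restrictions
to the period cell `(-π, π)`. -/
abbrev L2per : Type := Lp ℂ 2 (volume.restrict (Ioo (-Real.pi) Real.pi))

theorem L2per.integrable (v : L2per) : IntegrableOn v (Ioo (-Real.pi) Real.pi) :=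
  (Lp.memLp v).integrable (by norm_num)

/-- The subspace of `L²_per` of functions with zero mean. -/
def zeroMean : Submodule ℂ L2per where
  carrier := {v | ∫ z in Ioo (-Real.pi) Real.pi, v z = 0}
  zero_mem' := by
    have h := Lp.coeFn_zero ℂ 2 (volume.restrict (Ioo (-Real.pi) Real.pi))
    simp only [mem_ofPred_eq]
    rw [integral_congr_ae h]
    simp
  add_mem' := by
    intro v w hv hw
    simp only [mem_ofPred_eq] at *
    rw [integral_congr_ae (Lp.coeFn_add v w)]
    simp only [Pi.add_apply]
    rw [integral_add v.integrable w.integrable, hv, hw, add_zero]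
  smul_mem' := by
    intro c v hv
    simp only [mem_ofPred_eq] at *
    rw [integral_congr_ae (Lp.coeFn_smul c v)]
    simp only [Pi.smul_apply]
    rw [integral_smul, hv, smul_zero]

/-- The Hilbert space `L̇²_per` with the norm of `L²(-π, π)`. -/
abbrev L2dot : Type := zeroMean

/-! ### The derivative of periodic distributions -/

/-- `g` is the derivative of `f` in the sense of `2π`-periodic distributions: both are integrable
over a period, and `∫ f φ' = -∫ g φ` for every smooth `2π`-periodic test function `φ`. -/
def HasPeriodicWeakDeriv (f g : ℝ → ℂ) : Prop :=
  IntegrableOn f (Ioo (-Real.pi) Real.pi) ∧ IntegrableOn g (Ioo (-Real.pi) Real.pi) ∧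
    ∀ φ : ℝ → ℂ, ContDiff ℝ ∞ φ → Function.Periodic φ (2 * Real.pi) →
      ∫ z in Ioo (-Real.pi) Real.pi, f z * deriv φ z =
        -∫ z in Ioo (-Real.pi) Real.pi, g z * φ z

theorem integrableOn_mul_of_continuous {f φ : ℝ → ℂ}
    (hf : IntegrableOn f (Ioo (-Real.pi) Real.pi)) (hφ : Continuous φ) :
    IntegrableOn (fun z => f z * φ z) (Ioo (-Real.pi) Real.pi) := by
  obtain ⟨C, hC⟩ := (isCompact_Icc (a := -Real.pi) (b := Real.pi)).exists_bound_of_continuousOn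
    hφ.continuousOn
  refine Integrable.mul_bdd (c := C) hf hφ.aestronglyMeasurable ?_
  filter_upwards [ae_restrict_mem measurableSet_Ioo] with z hz
  exact hC z (Ioo_subset_Icc_self hz)

theorem HasPeriodicWeakDeriv.congr {f f' g g' : ℝ → ℂ} (h : HasPeriodicWeakDeriv f g)
    (hf : f =ᵐ[volume.restrict (Ioo (-Real.pi) Real.pi)] f')
    (hg : g =ᵐ[volume.restrict (Ioo (-Real.pi) Real.pi)] g') : HasPeriodicWeakDeriv f' g' := by
  refine ⟨Integrable.congr h.1 hf, Integrable.congr h.2.1 hg, fun φ h1 h2 => ?_⟩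
  have e1 : ∫ z in Ioo (-Real.pi) Real.pi, f' z * deriv φ z =
      ∫ z in Ioo (-Real.pi) Real.pi, f z * deriv φ z :=
    integral_congr_ae (by filter_upwards [hf] with z hz; rw [hz])
  have e2 : ∫ z in Ioo (-Real.pi) Real.pi, g' z * φ z =
      ∫ z in Ioo (-Real.pi) Real.pi, g z * φ z :=
    integral_congr_ae (by filter_upwards [hg] with z hz; rw [hz])
  rw [e1, e2, h.2.2 φ h1 h2]

theorem HasPeriodicWeakDeriv.add {f f' g g' : ℝ → ℂ} (h : HasPeriodicWeakDeriv f g)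
    (h' : HasPeriodicWeakDeriv f' g') :
    HasPeriodicWeakDeriv (fun z => f z + f' z) (fun z => g z + g' z) := by
  refine ⟨Integrable.add h.1 h'.1, Integrable.add h.2.1 h'.2.1, fun φ h1 h2 => ?_⟩
  have hd : Continuous (deriv φ) := h1.continuous_deriv (by simp)
  simp only [add_mul]
  rw [integral_add (integrableOn_mul_of_continuous h.1 hd)
      (integrableOn_mul_of_continuous h'.1 hd),
    integral_add (integrableOn_mul_of_continuous h.2.1 h1.continuous)
      (integrableOn_mul_of_continuous h'.2.1 h1.continuous), h.2.2 φ h1 h2, h'.2.2 φ h1 h2]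
  ring

theorem HasPeriodicWeakDeriv.const_mul {f g : ℝ → ℂ} (h : HasPeriodicWeakDeriv f g) (a : ℂ) :
    HasPeriodicWeakDeriv (fun z => a * f z) (fun z => a * g z) := by
  refine ⟨Integrable.const_mul h.1 a, Integrable.const_mul h.2.1 a, fun φ h1 h2 => ?_⟩
  simp only [mul_assoc]
  rw [integral_const_mul, integral_const_mul, h.2.2 φ h1 h2]
  ring

/-- A square integrable derivative of zero vanishes. -/
theorem HasPeriodicWeakDeriv.eq_zero {f : ℝ → ℂ} {g : L2per} (h : HasPeriodicWeakDeriv f g)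
    (hf : f =ᵐ[volume.restrict (Ioo (-Real.pi) Real.pi)] 0) : g = 0 := by
  have hab : -Real.pi < Real.pi := by linarith [Real.pi_pos]
  have hg : MemLp g 2 (volume.restrict (Ioc (-Real.pi) Real.pi)) := by
    rw [← restrict_Ioo_eq_restrict_Ioc]
    exact Lp.memLp g
  have hs := hasSum_sq_fourierCoeffOn hab hg
  have h0 : ∀ n : ℤ, fourierCoeffOn hab g n = 0 := by
    intro n
    have hφ := (h.congr hf (Filter.EventuallyEq.refl _ _)).2.2
      (fun z : ℝ => Complex.exp (-(Complex.I * n * z))) (by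
        have h1 : ContDiff ℝ ∞ (fun z : ℝ => (z : ℂ)) := Complex.ofRealCLM.contDiff
        fun_prop) (by
        intro z
        simp only
        rw [Complex.exp_eq_exp_iff_exists_int]
        refine ⟨-n, ?_⟩
        push_cast
        ring)
    simp only [Pi.zero_apply, zero_mul, integral_zero] at hφ
    rw [fourierCoeffOn_eq_integral, intervalIntegral.integral_of_le hab.le,
      ← restrict_Ioo_eq_restrict_Ioc]
    have e : ∫ x in Ioo (-Real.pi) Real.pi,
        fourier (-n) (x : AddCircle (Real.pi - -Real.pi)) • g x =
        ∫ z in Ioo (-Real.pi) Real.pi, g z * Complex.exp (-(Complex.I * n * z)) := by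
      refine integral_congr_ae (Filter.Eventually.of_forall fun z => ?_)
      simp only [fourier_coe_apply, smul_eq_mul]
      rw [mul_comm]
      congr 2
      have : (Real.pi : ℂ) ≠ 0 := by exact_mod_cast Real.pi_ne_zero
      push_cast
      field_simp
      ring
    rw [e, neg_eq_zero.mp hφ.symm, smul_zero]
  simp only [h0, norm_zero, ne_eq, OfNat.ofNat_ne_zero, not_false_eq_true, zero_pow] at hs
  have hz := hs.unique hasSum_zero
  have hpos : (Real.pi - -Real.pi)⁻¹ ≠ 0 := inv_ne_zero (by linarith)
  rw [smul_eq_zero, or_iff_right hpos, intervalIntegral.integral_of_le hab.le,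
    ← restrict_Ioo_eq_restrict_Ioc,
    integral_eq_zero_iff_of_nonneg (fun _ => sq_nonneg _) (Lp.memLp g).integrable_norm_pow'] at hz
  rw [Lp.eq_zero_iff_ae_eq_zero]
  filter_upwards [hz] with z hz
  simpa using hz

/-! ### The linearized operator at a traveling wave -/

/-- The graph of `v ↦ ∂_z [(c - U) v]` in `L̇²_per × L̇²_per`. -/
def transportGraph (c : ℝ) (U : ℝ → ℝ) : Submodule ℂ (L2dot × L2dot) where
  carrier := {p | HasPeriodicWeakDeriv (fun z => ((c - U z : ℝ) : ℂ) * (p.1 : L2per) z)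
    (p.2 : L2per)}
  zero_mem' := by
    have h0 := Lp.coeFn_zero ℂ 2 (volume.restrict (Ioo (-Real.pi) Real.pi))
    have h : HasPeriodicWeakDeriv (fun _ => 0) (fun _ => 0) :=
      ⟨integrableOn_zero, integrableOn_zero, by simp⟩
    refine h.congr ?_ h0.symm
    filter_upwards [h0] with z hz
    change 0 = ((c - U z : ℝ) : ℂ) * (0 : L2per) z
    rw [hz, Pi.zero_apply, mul_zero]
  add_mem' := by
    rintro ⟨v, w⟩ ⟨v', w'⟩ h h'
    refine (HasPeriodicWeakDeriv.add h h').congr ?_ (Lp.coeFn_add (w : L2per) w').symm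
    filter_upwards [Lp.coeFn_add (v : L2per) v'] with z hz
    simp only [Prod.mk_add_mk, Submodule.coe_add, hz, Pi.add_apply, mul_add]
  smul_mem' := by
    rintro a ⟨v, w⟩ h
    refine (HasPeriodicWeakDeriv.const_mul h a).congr ?_ (Lp.coeFn_smul a (w : L2per)).symm
    filter_upwards [Lp.coeFn_smul a (v : L2per)] with z hz
    simp only [Prod.smul_mk, Submodule.coe_smul, hz, Pi.smul_apply, smul_eq_mul]
    ring

theorem transportGraph_functional (c : ℝ) (U : ℝ → ℝ) (p : L2dot × L2dot)
    (hp : p ∈ transportGraph c U) (h0 : p.1 = 0) : p.2 = 0 := by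
  have h : HasPeriodicWeakDeriv (fun z => ((c - U z : ℝ) : ℂ) * (p.1 : L2per) z) (p.2 : L2per) := hp
  refine Subtype.ext (h.eq_zero ?_)
  rw [h0]
  filter_upwards [Lp.coeFn_zero ℂ 2 (volume.restrict (Ioo (-Real.pi) Real.pi))] with z hz
  change ((c - U z : ℝ) : ℂ) * (0 : L2per) z = 0
  rw [hz, Pi.zero_apply, mul_zero]

/-- The operator `A₀ v = ∂_z [(c - U) v]` in `L̇²_per` with its maximal domain
`{v ∈ L̇²_per : ∂_z [(c - U) v] ∈ L̇²_per}`. -/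
def transportOperator (c : ℝ) (U : ℝ → ℝ) : L2dot →ₗ.[ℂ] L2dot :=
  (transportGraph c U).toLinearPMap

theorem mem_transportOperator_domain (c : ℝ) (U : ℝ → ℝ) (v : L2dot) :
    v ∈ (transportOperator c U).domain ↔
      ∃ g : L2dot, HasPeriodicWeakDeriv (fun z => ((c - U z : ℝ) : ℂ) * (v : L2per) z)
        (g : L2per) := by
  simp [transportOperator, Submodule.toLinearPMap_domain, transportGraph]

theorem transportOperator_spec (c : ℝ) (U : ℝ → ℝ) (v : (transportOperator c U).domain) :
    HasPeriodicWeakDeriv (fun z => ((c - U z : ℝ) : ℂ) * ((v : L2dot) : L2per) z)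
      (transportOperator c U v : L2per) :=
  Submodule.mem_graph_toLinearPMap (transportGraph_functional c U) v

/-- The primitive `z ↦ ∫_{-π}^z v` on the period cell. -/
def primitive (v : L2per) (z : ℝ) : ℂ := ∫ t in (-Real.pi)..z, v t

/-- The primitive of `v` corrected by a constant so that it has zero mean. -/
def zeroMeanPrimitive (v : L2per) (z : ℝ) : ℂ :=
  primitive v z -
    ((2 * Real.pi : ℝ) : ℂ)⁻¹ * ∫ s in Ioo (-Real.pi) Real.pi, primitive v s

theorem intervalIntegrable (v : L2per) {z : ℝ} (hz : z ∈ Ioo (-Real.pi) Real.pi) :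
    IntervalIntegrable v volume (-Real.pi) z := by
  rw [intervalIntegrable_iff, uIoc_of_le hz.1.le]
  exact v.integrable.mono_set fun t ht => ⟨ht.1, ht.2.trans_lt hz.2⟩

theorem memLp_primitive (v : L2per) :
    MemLp (primitive v) 2 (volume.restrict (Ioo (-Real.pi) Real.pi)) := by
  have hab : -Real.pi ≤ Real.pi := by linarith [Real.pi_pos]
  have hc : ContinuousOn (primitive v) (Icc (-Real.pi) Real.pi) := by
    have := intervalIntegral.continuousOn_primitive_interval (μ := volume) (f := v)
      (a := -Real.pi) (b := Real.pi) (by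
        rw [uIcc_of_le hab, integrableOn_Icc_iff_integrableOn_Ioo]
        exact v.integrable)
    rwa [uIcc_of_le hab] at this
  obtain ⟨C, hC⟩ := isCompact_Icc.exists_bound_of_continuousOn hc
  refine MemLp.of_bound
    ((hc.mono Ioo_subset_Icc_self).aestronglyMeasurable measurableSet_Ioo) C ?_
  filter_upwards [ae_restrict_mem measurableSet_Ioo] with z hz
  exact hC z (Ioo_subset_Icc_self hz)

theorem integrable_primitive (v : L2per) :
    IntegrableOn (primitive v) (Ioo (-Real.pi) Real.pi) :=
  (memLp_primitive v).integrable (by norm_num)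

theorem memLp_zeroMeanPrimitive (v : L2per) :
    MemLp (zeroMeanPrimitive v) 2 (volume.restrict (Ioo (-Real.pi) Real.pi)) :=
  (memLp_primitive v).sub (memLp_const _)

theorem integral_zeroMeanPrimitive (v : L2per) :
    ∫ z in Ioo (-Real.pi) Real.pi, zeroMeanPrimitive v z = 0 := by
  simp only [zeroMeanPrimitive]
  rw [integral_sub (integrable_primitive v) (integrable_const _), setIntegral_const]
  have h1 : volume.real (Ioo (-Real.pi) Real.pi) = 2 * Real.pi := by
    rw [Real.volume_real_Ioo_of_le (by linarith [Real.pi_pos])]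
    ring
  have h2 : ((2 * Real.pi : ℝ) : ℂ) ≠ 0 := by
    exact_mod_cast (by positivity : (2 * Real.pi : ℝ) ≠ 0)
  rw [h1, Complex.real_smul, mul_inv_cancel_left₀ h2, sub_self]

theorem primitive_add (v w : L2per) {z : ℝ} (hz : z ∈ Ioo (-Real.pi) Real.pi) :
    primitive (v + w) z = primitive v z + primitive w z := by
  simp only [primitive]
  rw [← intervalIntegral.integral_add (intervalIntegrable v hz) (intervalIntegrable w hz)]
  refine intervalIntegral.integral_congr_ae ?_
  rw [uIoc_of_le hz.1.le]
  have := (ae_restrict_iff' measurableSet_Ioo).1 (Lp.coeFn_add v w)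
  filter_upwards [this] with t ht hm
  exact ht ⟨hm.1, hm.2.trans_lt hz.2⟩

theorem primitive_smul (a : ℂ) (v : L2per) {z : ℝ} (hz : z ∈ Ioo (-Real.pi) Real.pi) :
    primitive (a • v) z = a * primitive v z := by
  simp only [primitive]
  rw [← intervalIntegral.integral_const_mul]
  refine intervalIntegral.integral_congr_ae ?_
  rw [uIoc_of_le hz.1.le]
  have := (ae_restrict_iff' measurableSet_Ioo).1 (Lp.coeFn_smul a v)
  filter_upwards [this] with t ht hm
  exact ht ⟨hm.1, hm.2.trans_lt hz.2⟩

/-- The operator `∂_z⁻¹` on `L̇²_per`: the antiderivative with zero mean. -/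
def antiderivative : L2dot →ₗ[ℂ] L2dot where
  toFun v := ⟨(memLp_zeroMeanPrimitive v).toLp _, by
    change ∫ z in Ioo (-Real.pi) Real.pi, _ = 0
    rw [integral_congr_ae (MemLp.coeFn_toLp _), integral_zeroMeanPrimitive]⟩
  map_add' v w := by
    refine Subtype.ext ?_
    change MemLp.toLp _ (memLp_zeroMeanPrimitive _) = MemLp.toLp _ (memLp_zeroMeanPrimitive _) +
      MemLp.toLp _ (memLp_zeroMeanPrimitive _)
    rw [← MemLp.toLp_add]
    refine MemLp.toLp_congr _ _ ?_
    have e : ∫ s in Ioo (-Real.pi) Real.pi, primitive ((v : L2per) + w) s =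
        (∫ s in Ioo (-Real.pi) Real.pi, primitive v s) +
          ∫ s in Ioo (-Real.pi) Real.pi, primitive w s := by
      rw [← integral_add (integrable_primitive v) (integrable_primitive w)]
      exact setIntegral_congr_fun measurableSet_Ioo fun z hz => primitive_add _ _ hz
    filter_upwards [ae_restrict_mem measurableSet_Ioo] with z hz
    simp only [zeroMeanPrimitive, Submodule.coe_add, Pi.add_apply, primitive_add _ _ hz, e]
    ring
  map_smul' a v := by
    refine Subtype.ext ?_
    change MemLp.toLp _ (memLp_zeroMeanPrimitive _) =
      a • MemLp.toLp _ (memLp_zeroMeanPrimitive _)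
    rw [← MemLp.toLp_const_smul]
    refine MemLp.toLp_congr _ _ ?_
    have e : ∫ s in Ioo (-Real.pi) Real.pi, primitive (a • (v : L2per)) s =
        a * ∫ s in Ioo (-Real.pi) Real.pi, primitive v s := by
      rw [← integral_const_mul]
      exact setIntegral_congr_fun measurableSet_Ioo fun z hz => primitive_smul _ _ hz
    filter_upwards [ae_restrict_mem measurableSet_Ioo] with z hz
    simp only [zeroMeanPrimitive, Submodule.coe_smul, Pi.smul_apply, smul_eq_mul,
      primitive_smul _ _ hz, e]
    ring

/-- The linearization `A v = ∂_z [(c - U) v] + ∂_z⁻¹ v` of `u_t + u u_x = ∂_x⁻¹ u` at a traveling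
wave `u(x, t) = U(x - c t)`, with the domain of `transportOperator c U`. -/
def linearizedOperator (c : ℝ) (U : ℝ → ℝ) : L2dot →ₗ.[ℂ] L2dot :=
  antiderivative +ᵥ transportOperator c U

/-! ### Spectrum and spectral stability -/

/-- The resolvent set of an unbounded operator: `A - lam` has trivial kernel and full range, and
its inverse is bounded. -/
def resolventSet {E : Type*} [NormedAddCommGroup E] [NormedSpace ℂ E] (A : E →ₗ.[ℂ] E) : Set ℂ :=
  {lam | (∀ v : A.domain, A v - lam • (v : E) = 0 → (v : E) = 0) ∧
    (∀ w : E, ∃ v : A.domain, A v - lam • (v : E) = w) ∧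
    ∃ C : ℝ, ∀ v : A.domain, ‖(v : E)‖ ≤ C * ‖A v - lam • (v : E)‖}

/-- The spectrum of an unbounded operator. -/
def spectrum {E : Type*} [NormedAddCommGroup E] [NormedSpace ℂ E] (A : E →ₗ.[ℂ] E) : Set ℂ :=
  (resolventSet A)ᶜ

/-- Spectral stability of a traveling wave of `u_t + u u_x = ∂_x⁻¹ u` with speed `c` and profile
`U`: the spectrum of the linearized operator lies on the imaginary axis. -/
def IsSpectrallyStable (c : ℝ) (U : ℝ → ℝ) : Prop :=
  spectrum (linearizedOperator c U) ⊆ {lam | lam.re = 0}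

/-- A traveling wave is spectrally unstable if it is not spectrally stable. -/
def IsSpectrallyUnstable (c : ℝ) (U : ℝ → ℝ) : Prop := ¬ IsSpectrallyStable c U

/-! ### The peaked wave -/

/-- The speed `c_* = π² / 9` of the peaked wave. -/
def peakedSpeed : ℝ := Real.pi ^ 2 / 9

/-- The peaked wave: `U_*(z) = (3 z² - π²) / 18` for `z ∈ [-π, π]`, continued `2π`-periodically. -/
def peakedWave (z : ℝ) : ℝ :=
  (3 * toIocMod Real.two_pi_pos (-Real.pi) z ^ 2 - Real.pi ^ 2) / 18

theorem peakedWave_eq {z : ℝ} (hz : z ∈ Icc (-Real.pi) Real.pi) :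
    peakedWave z = (3 * z ^ 2 - Real.pi ^ 2) / 18 := by
  rcases hz.1.eq_or_lt with h | h
  · rw [peakedWave, ← h, toIocMod_apply_left]
    ring
  · rw [peakedWave, (toIocMod_eq_self Real.two_pi_pos).2 ⟨h, by linarith [hz.2]⟩]

end

end Ostrovsky

/-!
On the period cell `c_* - U_*(z) = (π² - z²) / 6 =: a(z)`, so `A = A₀ + ∂_z⁻¹` with
`A₀ v = (a v)'`, where `a` vanishes at the peak `z = ±π` with slopes `∓π / 3`.

*Outside the strip.* Integration by parts gives `2 Re ⟨v, A₀ v⟩ = ∫ a' |v|²`, hence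
`|Re ⟨v, A₀ v⟩| ≤ (π / 6) ‖v‖²` (`abs_re_inner_transportOperator_le`); there is no boundary term,
because the limits of `a |v|²` at `±π` exist and a nonzero limit would contradict `v ∈ L²`
(`IsPrimitiveOn.exists_energy_extension`). Since `∂_z⁻¹` is skew-adjoint, all the operators
`A₀ + t ∂_z⁻¹ - lam` with real `t` are bounded below by `|Re lam| - π / 6`. For `t = 0` the equation
is solved by variation of constants (`exists_transport_resolvent`), and surjectivity is carried to
`t = 1` by the method of continuity (`mem_resolventSet_vadd_of_skew`).

*Inside the strip.* Let `y' = 1 / a` and `ρ = exp (-lam y)`, so that `(a v)' - lam v = f` becomes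
`(ρ a v)' = ρ f`. For `|Re lam| < π / 6` the function `ρ` is square integrable and `ρ a v` vanishes
at both ends, so `A₀ - lam` is injective and its range is orthogonal to `ρ̄`; for `lam ≠ 0` this is
a proper subspace (`IsPrimitiveOn.integratingFactor_mul`,
`exists_integral_integratingFactor_mul_ne_zero`). If `lam` were in the resolvent set of `A`, then
`(A₀ - lam) (A - lam)⁻¹ = 1 - ∂_z⁻¹ (A - lam)⁻¹` would be an injective compact perturbation of the
identity, hence surjective by the Fredholm alternative (`surjective_of_mem_resolventSet_vadd`), a
contradiction. The boundary of the strip and `lam = 0` follow since the resolvent set is open.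
-/

namespace Ostrovsky

open Filter Topology

/-! ### Primitives of integrable functions -/

/-- `G` is a primitive of the integrable function `h` on `[a, b]`, that is, `G` is absolutely
continuous there with `G' = h` almost everywhere. This is stated through the values of the
integrals of `h`, so that no pointwise derivative is involved. -/
structure IsPrimitiveOn (G h : ℝ → ℂ) (a b : ℝ) : Prop where
  intervalIntegrable : IntervalIntegrable h volume a b
  integral_eq : ∀ x ∈ Icc a b, ∀ y ∈ Icc a b, ∫ t in x..y, h t = G y - G x

/-- The product rule for primitives of real integrable functions. -/
theorem integral_mul_primitive_add {f g : ℝ → ℝ} {a b : ℝ} (hf : IntervalIntegrable f volume a b)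
    (hg : IntervalIntegrable g volume a b) (c d : ℝ) :
    ∫ x in a..b, (f x * (d + ∫ t in a..x, g t) + (c + ∫ t in a..x, f t) * g x) =
      (c + ∫ t in a..b, f t) * (d + ∫ t in a..b, g t) - c * d := by
  have hc : ∀ e : ℝ, AbsolutelyContinuousOnInterval (fun _ : ℝ => e) a b := fun e =>
    (LipschitzWith.const e).lipschitzOnWith.absolutelyContinuousOnInterval
  have hF : AbsolutelyContinuousOnInterval (fun x => c + ∫ t in a..x, f t) a b :=
    (hc c).add (hf.absolutelyContinuousOnInterval_intervalIntegral left_mem_uIcc)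
  have hG : AbsolutelyContinuousOnInterval (fun x => d + ∫ t in a..x, g t) a b :=
    (hc d).add (hg.absolutelyContinuousOnInterval_intervalIntegral left_mem_uIcc)
  have h := hF.integral_deriv_mul_eq_sub hG
  simp only [intervalIntegral.integral_same, add_zero] at h
  rw [← h]
  refine intervalIntegral.integral_congr_ae ?_
  filter_upwards [hf.ae_hasDerivAt_integral, hg.ae_hasDerivAt_integral] with x h1 h2 hx
  have hx' := uIoc_subset_uIcc hx
  rw [((h1 hx' a left_mem_uIcc).const_add c).deriv, ((h2 hx' a left_mem_uIcc).const_add d).deriv]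

/-- The product rule for primitives of complex integrable functions. -/
theorem integral_mul_primitive_add_complex {f g : ℝ → ℂ} {a b : ℝ}
    (hf : IntervalIntegrable f volume a b) (hg : IntervalIntegrable g volume a b) (c d : ℂ) :
    ∫ x in a..b, (f x * (d + ∫ t in a..x, g t) + (c + ∫ t in a..x, f t) * g x) =
      (c + ∫ t in a..b, f t) * (d + ∫ t in a..b, g t) - c * d := by
  have hfr : IntervalIntegrable (fun x => (f x).re) volume a b := ⟨hf.1.re, hf.2.re⟩
  have hfi : IntervalIntegrable (fun x => (f x).im) volume a b := ⟨hf.1.im, hf.2.im⟩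
  have hgr : IntervalIntegrable (fun x => (g x).re) volume a b := ⟨hg.1.re, hg.2.re⟩
  have hgi : IntervalIntegrable (fun x => (g x).im) volume a b := ⟨hg.1.im, hg.2.im⟩
  have re_int : ∀ {k : ℝ → ℂ} {u v : ℝ}, IntervalIntegrable k volume u v →
      (∫ t in u..v, k t).re = ∫ t in u..v, (k t).re := fun hk =>
    (Complex.reCLM.intervalIntegral_comp_comm hk).symm
  have im_int : ∀ {k : ℝ → ℂ} {u v : ℝ}, IntervalIntegrable k volume u v →
      (∫ t in u..v, k t).im = ∫ t in u..v, (k t).im := fun hk =>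
    (Complex.imCLM.intervalIntegral_comp_comm hk).symm
  have sub : ∀ {k : ℝ → ℂ}, IntervalIntegrable k volume a b → ∀ x ∈ uIcc a b,
      IntervalIntegrable k volume a x := fun hk x hx =>
    hk.mono_set (uIcc_subset_uIcc left_mem_uIcc hx)
  have cont : ∀ {k : ℝ → ℂ} (e : ℂ), IntervalIntegrable k volume a b →
      ContinuousOn (fun x => e + ∫ t in a..x, k t) (uIcc a b) := fun e hk =>
    continuousOn_const.add (intervalIntegral.continuousOn_primitive_interval' hk left_mem_uIcc)
  have contr : ∀ {k : ℝ → ℝ} (e : ℝ), IntervalIntegrable k volume a b →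
      ContinuousOn (fun x => e + ∫ t in a..x, k t) (uIcc a b) := fun e hk =>
    continuousOn_const.add (intervalIntegral.continuousOn_primitive_interval' hk left_mem_uIcc)
  have hI : IntervalIntegrable
      (fun x => f x * (d + ∫ t in a..x, g t) + (c + ∫ t in a..x, f t) * g x) volume a b :=
    (hf.mul_continuousOn (cont d hg)).add (hg.continuousOn_mul (cont c hf))
  have hJ : ∀ {p q : ℝ → ℝ} (e e' : ℝ), IntervalIntegrable p volume a b →
      IntervalIntegrable q volume a b → IntervalIntegrable
      (fun x => p x * (e' + ∫ t in a..x, q t) + (e + ∫ t in a..x, p t) * q x) volume a b :=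
    fun e e' hp hq => (hp.mul_continuousOn (contr e' hq)).add (hq.continuousOn_mul (contr e hp))
  apply Complex.ext
  · rw [re_int hI]
    have h1 := integral_mul_primitive_add hfr hgr c.re d.re
    have h2 := integral_mul_primitive_add hfi hgi c.im d.im
    simp only [Complex.sub_re, Complex.mul_re, Complex.add_re, Complex.add_im, re_int hf,
      re_int hg, im_int hf, im_int hg]
    have : ∀ A B C D : ℝ, A * B - C * D - (c.re * d.re - c.im * d.im) =
      (A * B - c.re * d.re) - (C * D - c.im * d.im) := by intros; ring
    rw [this, ← h1, ← h2, ← intervalIntegral.integral_sub (hJ _ _ hfr hgr) (hJ _ _ hfi hgi)]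
    refine intervalIntegral.integral_congr fun x hx => ?_
    simp only [re_int (sub hf x hx), re_int (sub hg x hx), im_int (sub hf x hx),
      im_int (sub hg x hx)]
    ring
  · rw [im_int hI]
    have h1 := integral_mul_primitive_add hfr hgi c.re d.im
    have h2 := integral_mul_primitive_add hfi hgr c.im d.re
    simp only [Complex.sub_im, Complex.mul_im, Complex.add_re, Complex.add_im, re_int hf,
      re_int hg, im_int hf, im_int hg]
    have : ∀ A B C D : ℝ, A * B + C * D - (c.re * d.im + c.im * d.re) =
      (A * B - c.re * d.im) + (C * D - c.im * d.re) := by intros; ring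
    rw [this, ← h1, ← h2, ← intervalIntegral.integral_add (hJ _ _ hfr hgi) (hJ _ _ hfi hgr)]
    refine intervalIntegral.integral_congr fun x hx => ?_
    simp only [re_int (sub hf x hx), re_int (sub hg x hx), im_int (sub hf x hx),
      im_int (sub hg x hx)]
    ring

namespace IsPrimitiveOn

variable {F G f g : ℝ → ℂ} {a b : ℝ}

theorem mono (hG : IsPrimitiveOn G g a b) {c d : ℝ} (hac : a ≤ c) (hcd : c ≤ d) (hdb : d ≤ b) :
    IsPrimitiveOn G g c d :=
  ⟨hG.1.mono_set (by
      rw [uIcc_of_le hcd, uIcc_of_le (hac.trans (hcd.trans hdb))]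
      exact Icc_subset_Icc hac hdb),
    fun x hx y hy => hG.2 x ⟨hac.trans hx.1, hx.2.trans hdb⟩ y ⟨hac.trans hy.1, hy.2.trans hdb⟩⟩

theorem eq_add (hG : IsPrimitiveOn G g a b) {x : ℝ} (hx : x ∈ Icc a b) :
    G x = G a + ∫ t in a..x, g t := by
  rw [hG.2 a ⟨le_rfl, hx.1.trans hx.2⟩ x hx]
  ring

theorem continuousOn (hG : IsPrimitiveOn G g a b) : ContinuousOn G (Icc a b) := by
  rcases le_or_gt a b with hab | hab
  · have h := (continuousOn_const (c := G a)).add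
      (intervalIntegral.continuousOn_primitive_interval' hG.1 left_mem_uIcc)
    rw [uIcc_of_le hab] at h
    exact h.congr fun x hx => hG.eq_add hx
  · rw [Icc_eq_empty hab.not_ge]
    exact continuousOn_empty G

theorem of_eq_add (hab : a ≤ b) (hg : IntervalIntegrable g volume a b)
    (h : ∀ x ∈ Icc a b, G x = G a + ∫ t in a..x, g t) : IsPrimitiveOn G g a b := by
  refine ⟨hg, fun x hx y hy => ?_⟩
  rw [h x hx, h y hy]
  have hs : ∀ x ∈ Icc a b, IntervalIntegrable g volume a x := fun x hx =>
    hg.mono_set (uIcc_subset_uIcc left_mem_uIcc (by rwa [uIcc_of_le hab]))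
  rw [← intervalIntegral.integral_interval_sub_left (hs y hy) (hs x hx)]
  ring

theorem congr_ae (hab : a ≤ b) (hG : IsPrimitiveOn G g a b)
    (hf : f =ᵐ[volume.restrict (Ioo a b)] g) : IsPrimitiveOn G f a b := by
  have hae : ∀ᵐ t, t ∈ Icc a b → f t = g t := by
    filter_upwards [(ae_restrict_iff' measurableSet_Ioo).1 hf, Measure.ae_ne volume a,
      Measure.ae_ne volume b] with t h h1 h2 ht
    exact h ⟨ht.1.lt_of_ne' h1, ht.2.lt_of_ne h2⟩
  refine ⟨hG.1.congr_ae ?_, fun x hx y hy => ?_⟩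
  · rw [EventuallyEq, ae_restrict_iff' measurableSet_uIoc, uIoc_of_le hab]
    filter_upwards [hae] with t ht hm
    exact (ht (Ioc_subset_Icc_self hm)).symm
  · rw [← hG.2 x hx y hy]
    refine intervalIntegral.integral_congr_ae ?_
    filter_upwards [hae] with t ht hm
    exact ht (uIcc_subset_Icc hx hy (uIoc_subset_uIcc hm))

theorem congr (hab : a ≤ b) (hG : IsPrimitiveOn G g a b) (hF : EqOn F G (Icc a b))
    (hf : EqOn f g (Ioo a b)) : IsPrimitiveOn F f a b := by
  have h := hG.congr_ae hab (hf.eventuallyEq_of_mem (self_mem_ae_restrict measurableSet_Ioo))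
  exact ⟨h.1, fun x hx y hy => by rw [hF hx, hF hy, ← h.2 x hx y hy]⟩

theorem mul (hab : a ≤ b) (hF : IsPrimitiveOn F f a b) (hG : IsPrimitiveOn G g a b) :
    IsPrimitiveOn (fun x => F x * G x) (fun x => f x * G x + F x * g x) a b := by
  have hu := uIcc_of_le hab
  refine of_eq_add hab ?_ fun x hx => ?_
  · exact (hF.1.mul_continuousOn (by rw [hu]; exact hG.continuousOn)).add
      (hG.1.continuousOn_mul (by rw [hu]; exact hF.continuousOn))
  · have hF' := hF.mono le_rfl hx.1 hx.2
    have hG' := hG.mono le_rfl hx.1 hx.2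
    have h := integral_mul_primitive_add_complex hF'.1 hG'.1 (F a) (G a)
    rw [← hF.eq_add hx, ← hG.eq_add hx] at h
    rw [← sub_eq_iff_eq_add', ← h]
    refine intervalIntegral.integral_congr fun t ht => ?_
    rw [uIcc_of_le hx.1] at ht
    simp only [← hF'.eq_add ht, ← hG'.eq_add ht]

theorem conj (hG : IsPrimitiveOn G g a b) :
    IsPrimitiveOn (fun x => (starRingEnd ℂ) (G x)) (fun x => (starRingEnd ℂ) (g x)) a b := by
  refine ⟨?_, fun x hx y hy => ?_⟩
  · exact ⟨(Complex.conjCLE : ℂ →L[ℝ] ℂ).integrable_comp hG.1.1,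
      (Complex.conjCLE : ℂ →L[ℝ] ℂ).integrable_comp hG.1.2⟩
  · rw [← map_sub, ← hG.2 x hx y hy]
    simp only [intervalIntegral, ← integral_conj, map_sub]

theorem comp_neg (hG : IsPrimitiveOn G g a b) :
    IsPrimitiveOn (fun x => G (-x)) (fun x => -g (-x)) (-b) (-a) := by
  refine ⟨?_, fun x hx y hy => ?_⟩
  · exact ((IntervalIntegrable.iff_comp_neg (by simp)).1 hG.1).symm.neg
  · rw [intervalIntegral.integral_neg, intervalIntegral.integral_comp_neg,
      hG.2 (-y) ⟨by linarith [hy.2], by linarith [hy.1]⟩ (-x) ⟨by linarith [hx.2],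
        by linarith [hx.1]⟩]
    ring

theorem of_hasDerivAt (hab : a ≤ b) (h : ∀ x ∈ Icc a b, HasDerivAt G (g x) x)
    (hg : ContinuousOn g (Icc a b)) : IsPrimitiveOn G g a b := by
  refine ⟨ContinuousOn.intervalIntegrable (by rwa [uIcc_of_le hab]), fun x hx y hy => ?_⟩
  have hs := uIcc_subset_Icc hx hy
  exact intervalIntegral.integral_eq_sub_of_hasDerivAt (fun t ht => h t (hs ht))
    (hg.mono hs).intervalIntegrable

end IsPrimitiveOn

/-! ### Periodic weak derivatives and primitives -/

theorem neg_pi_le_pi : -Real.pi ≤ Real.pi := by linarith [Real.pi_pos]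

theorem integral_cell (f : ℝ → ℂ) :
    ∫ z in Ioo (-Real.pi) Real.pi, f z = ∫ z in (-Real.pi)..Real.pi, f z := by
  rw [intervalIntegral.integral_of_le neg_pi_le_pi, integral_Ioc_eq_integral_Ioo]

theorem intervalIntegrable_cell_iff {E : Type*} [NormedAddCommGroup E] {f : ℝ → E} :
    IntervalIntegrable f volume (-Real.pi) Real.pi ↔
      IntegrableOn f (Ioo (-Real.pi) Real.pi) := by
  rw [intervalIntegrable_iff_integrableOn_Ioc_of_le neg_pi_le_pi,
    integrableOn_Ioc_iff_integrableOn_Ioo]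

theorem IsPrimitiveOn.hasPeriodicWeakDeriv {G g : ℝ → ℂ}
    (h : IsPrimitiveOn G g (-Real.pi) Real.pi) (hper : G (-Real.pi) = G Real.pi) :
    HasPeriodicWeakDeriv G g := by
  have hGi : IntegrableOn G (Ioo (-Real.pi) Real.pi) :=
    (h.continuousOn.integrableOn_compact isCompact_Icc).mono_set Ioo_subset_Icc_self
  have hgi := intervalIntegrable_cell_iff.1 h.1
  refine ⟨hGi, hgi, fun φ h1 h2 => ?_⟩
  have hd : Continuous (deriv φ) := h1.continuous_deriv (by simp)
  have hφ : IsPrimitiveOn φ (deriv φ) (-Real.pi) Real.pi :=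
    .of_hasDerivAt neg_pi_le_pi (fun x _ => (h1.differentiable (by simp) x).hasDerivAt)
      hd.continuousOn
  have hp : φ (-Real.pi) = φ Real.pi := by
    rw [← h2 (-Real.pi)]
    congr 1
    ring
  have := (h.mul neg_pi_le_pi hφ).2 _ (left_mem_Icc.2 neg_pi_le_pi) _
    (right_mem_Icc.2 neg_pi_le_pi)
  rw [← integral_cell, integral_add (integrableOn_mul_of_continuous hgi h1.continuous)
    (integrableOn_mul_of_continuous hGi hd), hper, hp, sub_self] at this
  exact eq_neg_of_add_eq_zero_right this

/-- A smooth periodic function is, up to its mean, the derivative of a smooth periodic function. -/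
theorem exists_periodic_antiderivative {φ : ℝ → ℂ} (h1 : ContDiff ℝ ∞ φ)
    (h2 : Function.Periodic φ (2 * Real.pi)) :
    ∃ (ψ : ℝ → ℂ) (c : ℂ), ContDiff ℝ ∞ ψ ∧ Function.Periodic ψ (2 * Real.pi) ∧
      ∀ z, φ z = deriv ψ z + c := by
  have hpi : ((2 * Real.pi : ℝ) : ℂ) ≠ 0 := by
    exact_mod_cast (by positivity : (2 * Real.pi : ℝ) ≠ 0)
  set c : ℂ := ((2 * Real.pi : ℝ) : ℂ)⁻¹ * ∫ t in (0 : ℝ)..(2 * Real.pi), φ t with hc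
  have hcont : Continuous fun t => φ t - c := h1.continuous.sub continuous_const
  have hd : ∀ z, HasDerivAt (fun z => ∫ t in (0 : ℝ)..z, (φ t - c)) (φ z - c) z := fun z =>
    intervalIntegral.integral_hasDerivAt_right (hcont.intervalIntegrable _ _)
      hcont.stronglyMeasurable.stronglyMeasurableAtFilter hcont.continuousAt
  refine ⟨fun z => ∫ t in (0 : ℝ)..z, (φ t - c), c, ?_, fun z => ?_, fun z => ?_⟩
  · rw [contDiff_infty_iff_deriv]
    refine ⟨fun z => (hd z).differentiableAt, ?_⟩
    rw [show deriv (fun z => ∫ t in (0 : ℝ)..z, (φ t - c)) = fun z => φ z - c from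
      funext fun z => (hd z).deriv]
    exact h1.sub contDiff_const
  · have h3 : Function.Periodic (fun t => φ t - c) (2 * Real.pi) := fun t => by
      simp only [h2 t]
    have h4 := h3.intervalIntegral_add_eq z 0
    have h5 : ∫ t in (0 : ℝ)..(2 * Real.pi), (φ t - c) = 0 := by
      rw [intervalIntegral.integral_sub (h1.continuous.intervalIntegrable _ _)
        (continuous_const.intervalIntegrable _ _), intervalIntegral.integral_const, sub_zero,
        Complex.real_smul, hc, mul_inv_cancel_left₀ hpi, sub_self]
    rw [zero_add, h5] at h4
    simp only
    rw [← intervalIntegral.integral_add_adjacent_intervals (hcont.intervalIntegrable 0 z)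
      (hcont.intervalIntegrable z _), h4, add_zero]
  · rw [(hd z).deriv]
    ring

/-- A square integrable function whose periodic weak derivative vanishes is constant. -/
theorem HasPeriodicWeakDeriv.exists_ae_eq_const {h : ℝ → ℂ}
    (hh : MemLp h 2 (volume.restrict (Ioo (-Real.pi) Real.pi)))
    (hw : HasPeriodicWeakDeriv h fun _ => 0) :
    ∃ m : ℂ, ∀ᵐ z ∂volume.restrict (Ioo (-Real.pi) Real.pi), h z = m := by
  have hpi : ((2 * Real.pi : ℝ) : ℂ) ≠ 0 := by
    exact_mod_cast (by positivity : (2 * Real.pi : ℝ) ≠ 0)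
  set m : ℂ := ((2 * Real.pi : ℝ) : ℂ)⁻¹ * ∫ z in Ioo (-Real.pi) Real.pi, h z with hm
  have hL : MemLp (fun z => h z - m) 2 (volume.restrict (Ioo (-Real.pi) Real.pi)) :=
    hh.sub (memLp_const _)
  have hi : IntegrableOn h (Ioo (-Real.pi) Real.pi) := hw.1
  have hLi : IntegrableOn (fun z => h z - m) (Ioo (-Real.pi) Real.pi) :=
    hL.integrable (by norm_num)
  have hmean : ∫ z in Ioo (-Real.pi) Real.pi, (h z - m) = 0 := by
    rw [integral_sub hi (integrable_const _), setIntegral_const,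
      Real.volume_real_Ioo_of_le neg_pi_le_pi, show Real.pi - -Real.pi = 2 * Real.pi by ring,
      Complex.real_smul, hm, mul_inv_cancel_left₀ hpi, sub_self]
  -- Testing with `φ = ψ' + c` shows that `h - m` is itself a weak derivative of zero.
  have key : HasPeriodicWeakDeriv (fun _ => 0) (fun z => h z - m) := by
    refine ⟨integrableOn_zero, hLi, fun φ h1 h2 => ?_⟩
    obtain ⟨ψ, c, hψ, hψp, hφ⟩ := exists_periodic_antiderivative h1 h2
    have hd : Continuous (deriv ψ) := hψ.continuous_deriv (by simp)
    have hψP : IsPrimitiveOn (fun z => ψ z) (deriv ψ) (-Real.pi) Real.pi :=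
      .of_hasDerivAt neg_pi_le_pi (fun x _ => (hψ.differentiable (by simp) x).hasDerivAt)
        hd.continuousOn
    have hp : ψ (-Real.pi) = ψ Real.pi := by
      rw [← hψp (-Real.pi)]
      congr 1
      ring
    have e0 : ∫ z in Ioo (-Real.pi) Real.pi, deriv ψ z = 0 := by
      rw [integral_cell, hψP.2 _ (left_mem_Icc.2 neg_pi_le_pi) _ (right_mem_Icc.2 neg_pi_le_pi),
        hp, sub_self]
    have e1 : ∫ z in Ioo (-Real.pi) Real.pi, h z * deriv ψ z = 0 := by
      rw [hw.2.2 ψ hψ hψp]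
      simp
    have e2 : ∀ z, (h z - m) * φ z = h z * deriv ψ z - m * deriv ψ z + c * (h z - m) := by
      intro z
      rw [hφ z]
      ring
    have i2 : IntegrableOn (fun z => m * deriv ψ z) (Ioo (-Real.pi) Real.pi) :=
      (intervalIntegrable_cell_iff.1 hψP.1).const_mul m
    have i1 := integrableOn_mul_of_continuous hi hd
    have i12 : IntegrableOn (fun z => h z * deriv ψ z - m * deriv ψ z)
      (Ioo (-Real.pi) Real.pi) := i1.sub i2
    simp only [e2, zero_mul, integral_zero]
    rw [integral_add i12 (hLi.const_mul c), integral_sub i1 i2, integral_const_mul,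
      integral_const_mul, e0, e1, hmean]
    simp
  have hz := (key.congr (EventuallyEq.refl _ _) hL.coeFn_toLp.symm).eq_zero
    (EventuallyEq.refl _ _)
  refine ⟨m, ?_⟩
  have h0 := hL.coeFn_toLp
  rw [hz] at h0
  filter_upwards [h0, Lp.coeFn_zero ℂ 2 (volume.restrict (Ioo (-Real.pi) Real.pi))] with z h1 h2
  rw [h2, Pi.zero_apply] at h1
  exact sub_eq_zero.1 h1.symm

/-- A square integrable function with an integrable periodic weak derivative has an absolutely
continuous periodic representative. -/
theorem HasPeriodicWeakDeriv.exists_isPrimitiveOn {f g : ℝ → ℂ}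
    (hf : MemLp f 2 (volume.restrict (Ioo (-Real.pi) Real.pi))) (h : HasPeriodicWeakDeriv f g) :
    ∃ G : ℝ → ℂ, IsPrimitiveOn G g (-Real.pi) Real.pi ∧ G (-Real.pi) = G Real.pi ∧
      f =ᵐ[volume.restrict (Ioo (-Real.pi) Real.pi)] G := by
  have hg0 : ∫ z in (-Real.pi)..Real.pi, g z = 0 := by
    have := h.2.2 (fun _ => 1) contDiff_const (fun _ => rfl)
    simp only [deriv_const, mul_zero, integral_zero, mul_one] at this
    rw [← integral_cell]
    exact neg_eq_zero.1 this.symm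
  have hG : ∀ m : ℂ, IsPrimitiveOn (fun z => m + ∫ t in (-Real.pi)..z, g t) g
      (-Real.pi) Real.pi := fun m =>
    .of_eq_add neg_pi_le_pi (intervalIntegrable_cell_iff.2 h.2.1) fun x _ => by simp
  have hper : ∀ m : ℂ, (m + ∫ t in (-Real.pi)..(-Real.pi), g t) =
      m + ∫ t in (-Real.pi)..Real.pi, g t := by
    intro m
    rw [hg0, intervalIntegral.integral_same]
  have hw := h.add (((hG 0).hasPeriodicWeakDeriv (hper 0)).const_mul (-1))
  have hGL : MemLp (fun z => (0 : ℂ) + ∫ t in (-Real.pi)..z, g t) 2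
      (volume.restrict (Ioo (-Real.pi) Real.pi)) := by
    obtain ⟨C, hC⟩ := isCompact_Icc.exists_bound_of_continuousOn (hG 0).continuousOn
    refine MemLp.of_bound (((hG 0).continuousOn.mono Ioo_subset_Icc_self).aestronglyMeasurable
      measurableSet_Ioo) C ?_
    filter_upwards [ae_restrict_mem measurableSet_Ioo] with z hz
    exact hC z (Ioo_subset_Icc_self hz)
  obtain ⟨m, hm⟩ := HasPeriodicWeakDeriv.exists_ae_eq_const (hf.add (hGL.const_mul (-1)))
    (hw.congr (EventuallyEq.refl _ _) (Eventually.of_forall fun z => by ring))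
  refine ⟨_, hG m, hper m, ?_⟩
  filter_upwards [hm] with z hz
  simp only [Pi.add_apply] at hz
  rw [← hz]
  ring

/-! ### The energy identity for the transport operator -/

/-- The coefficient `c_* - U_*(z) = (π² - z²) / 6` of the transport operator on the period cell. -/
noncomputable def speedGap (z : ℝ) : ℝ := (Real.pi ^ 2 - z ^ 2) / 6

theorem peakedSpeed_sub_peakedWave {z : ℝ} (hz : z ∈ Ioo (-Real.pi) Real.pi) :
    peakedSpeed - peakedWave z = speedGap z := by
  rw [peakedWave_eq (Ioo_subset_Icc_self hz), peakedSpeed, speedGap]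
  ring

theorem speedGap_pos {z : ℝ} (hz : z ∈ Ioo (-Real.pi) Real.pi) : 0 < speedGap z := by
  have : 0 < (Real.pi - z) * (Real.pi + z) :=
    mul_pos (by linarith [hz.2]) (by linarith [hz.1])
  rw [speedGap]
  linarith [show (Real.pi - z) * (Real.pi + z) = Real.pi ^ 2 - z ^ 2 by ring]

theorem hasDerivAt_speedGap (z : ℝ) : HasDerivAt speedGap (-(z / 3)) z := by
  have h := (((hasDerivAt_id z).pow 2).const_sub (Real.pi ^ 2)).div_const 6
  convert! h using 1
  simp
  ring

theorem continuous_speedGap : Continuous speedGap := by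
  unfold speedGap
  fun_prop

/-- If `G' = h` and `G = (c_* - U_*) v`, then `(c_* - U_*) |v|²` is absolutely continuous inside the
period cell, with derivative `2 Re (h v̄) + (z / 3) |v|²`. -/
theorem IsPrimitiveOn.integral_energy {G h v : ℝ → ℂ} {α β : ℝ} (hα : -Real.pi < α) (hαβ : α ≤ β)
    (hβ : β < Real.pi) (hG : IsPrimitiveOn G h α β)
    (hv : ∀ z ∈ Ioo (-Real.pi) Real.pi, G z = speedGap z * v z) :
    IntervalIntegrable (fun z => 2 * (h z * (starRingEnd ℂ) (v z)).re + z / 3 * ‖v z‖ ^ 2)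
        volume α β ∧
      ∫ z in α..β, (2 * (h z * (starRingEnd ℂ) (v z)).re + z / 3 * ‖v z‖ ^ 2) =
        speedGap β * ‖v β‖ ^ 2 - speedGap α * ‖v α‖ ^ 2 := by
  have hs : ∀ z ∈ Icc α β, z ∈ Ioo (-Real.pi) Real.pi := fun z hz =>
    ⟨hα.trans_le hz.1, hz.2.trans_lt hβ⟩
  have hne : ∀ z ∈ Icc α β, (speedGap z : ℂ) ≠ 0 := fun z hz => by
    exact_mod_cast (speedGap_pos (hs z hz)).ne'
  have hinv : IsPrimitiveOn (fun z => ((speedGap z)⁻¹ : ℝ))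
      (fun z => ((-(-(z / 3)) / speedGap z ^ 2 : ℝ) : ℂ)) α β := by
    refine .of_hasDerivAt hαβ (fun z hz => ?_) ?_
    · exact ((hasDerivAt_speedGap z).inv (speedGap_pos (hs z hz)).ne').ofReal_comp
    · refine Complex.continuous_ofReal.comp_continuousOn (ContinuousOn.div (by fun_prop)
        (continuous_speedGap.pow 2).continuousOn fun z hz => ?_)
      exact pow_ne_zero 2 (speedGap_pos (hs z hz)).ne'
  have key : IsPrimitiveOn (fun z => ((speedGap z * ‖v z‖ ^ 2 : ℝ) : ℂ))
      (fun z => ((2 * (h z * (starRingEnd ℂ) (v z)).re + z / 3 * ‖v z‖ ^ 2 : ℝ) : ℂ)) α β := by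
    refine ((hG.mul hαβ hG.conj).mul hαβ hinv).congr hαβ (fun z hz => ?_) (fun z hz => ?_)
    · have := hne z hz
      simp only [hv z (hs z hz), map_mul, Complex.conj_ofReal]
      push_cast
      rw [← Complex.mul_conj']
      field_simp
    · have := hne z (Ioo_subset_Icc_self hz)
      have e : (((2 * (h z * (starRingEnd ℂ) (v z)).re : ℝ)) : ℂ) =
          h z * (starRingEnd ℂ) (v z) + v z * (starRingEnd ℂ) (h z) := by
        rw [← Complex.add_conj]
        simp [mul_comm]
      simp only [hv z (hs z (Ioo_subset_Icc_self hz)), map_mul, Complex.conj_ofReal]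
      rw [Complex.ofReal_add, e]
      push_cast
      rw [← Complex.mul_conj']
      field_simp
  constructor
  · have h1 := key.1
    have : IntervalIntegrable (fun z =>
        (((2 * (h z * (starRingEnd ℂ) (v z)).re + z / 3 * ‖v z‖ ^ 2 : ℝ) : ℂ)).re) volume α β :=
      ⟨h1.1.re, h1.2.re⟩
    simpa only [Complex.ofReal_re] using this
  · have h1 := key.2 α ⟨le_rfl, hαβ⟩ β ⟨hαβ, le_rfl⟩
    rw [intervalIntegral.integral_ofReal] at h1
    exact_mod_cast h1

/-- An integrable function near `e` cannot be bounded below by a positive multiple of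
`1 / |z - e|`. -/
theorem false_of_le_abs_sub_mul {n : ℝ → ℝ} {s t e c : ℝ} (hst : s < t) (he : e ∈ Icc s t)
    (hc : 0 < c) (hn : IntegrableOn n (Ioo s t)) (h : ∀ z ∈ Ioo s t, c ≤ |z - e| * n z) :
    False := by
  have hi : IntervalIntegrable (fun z => (z - e)⁻¹) volume s t := by
    rw [intervalIntegrable_iff_integrableOn_Ioc_of_le hst.le, integrableOn_Ioc_iff_integrableOn_Ioo]
    refine (hn.const_mul c⁻¹).mono' (by fun_prop) ?_
    filter_upwards [ae_restrict_mem measurableSet_Ioo] with z hz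
    have h1 := h z hz
    have h2 : 0 < |z - e| := by
      rcases (abs_nonneg (z - e)).eq_or_lt with h0 | h0
      · rw [← h0] at h1
        linarith
      · exact h0
    rw [norm_inv, Real.norm_eq_abs, inv_mul_eq_div, inv_eq_one_div, div_le_div_iff₀ h2 hc]
    linarith
  rcases intervalIntegrable_sub_inv_iff.1 hi with h0 | h0
  · exact hst.ne h0
  · rw [uIcc_of_le hst.le] at h0
    exact h0 he

theorem integrableOn_energy {h v : ℝ → ℂ}
    (hh : MemLp h 2 (volume.restrict (Ioo (-Real.pi) Real.pi)))
    (hvL : MemLp v 2 (volume.restrict (Ioo (-Real.pi) Real.pi))) :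
    IntegrableOn (fun z => 2 * (h z * (starRingEnd ℂ) (v z)).re + z / 3 * ‖v z‖ ^ 2)
      (Ioo (-Real.pi) Real.pi) := by
  have h1 : IntegrableOn (fun z => h z * (starRingEnd ℂ) (v z)) (Ioo (-Real.pi) Real.pi) :=
    hh.integrable_mul hvL.star
  have h2 : IntegrableOn (fun z => ‖v z‖ ^ 2) (Ioo (-Real.pi) Real.pi) :=
    hvL.integrable_norm_pow (by norm_num)
  refine (h1.re.const_mul 2).add ?_
  refine Integrable.bdd_mul (c := Real.pi) h2 (by fun_prop) ?_
  filter_upwards [ae_restrict_mem measurableSet_Ioo] with z hz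
  rw [Real.norm_eq_abs, abs_le]
  constructor <;> linarith [hz.1, hz.2, Real.pi_pos]

/-- If `G' = h` and `G = (c_* - U_*) v` with `h` and `v` square integrable, then
`(c_* - U_*) |v|²` extends continuously by zero to the end points of the period cell: its limits
exist, and a nonzero limit would make `|v|²` as large as the inverse distance to the end point. -/
theorem IsPrimitiveOn.exists_energy_extension {G h v : ℝ → ℂ}
    (hG : IsPrimitiveOn G h (-Real.pi) Real.pi)
    (hv : ∀ z ∈ Ioo (-Real.pi) Real.pi, G z = speedGap z * v z)
    (hh : MemLp h 2 (volume.restrict (Ioo (-Real.pi) Real.pi)))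
    (hvL : MemLp v 2 (volume.restrict (Ioo (-Real.pi) Real.pi))) :
    ∃ E : ℝ → ℝ, ContinuousOn E (Icc (-Real.pi) Real.pi) ∧
      (∀ z ∈ Ioo (-Real.pi) Real.pi, E z = speedGap z * ‖v z‖ ^ 2) ∧
      E (-Real.pi) = 0 ∧ E Real.pi = 0 ∧
      ∫ z in Ioo (-Real.pi) Real.pi,
        (2 * (h z * (starRingEnd ℂ) (v z)).re + z / 3 * ‖v z‖ ^ 2) = 0 := by
  set k : ℝ → ℝ := fun z => 2 * (h z * (starRingEnd ℂ) (v z)).re + z / 3 * ‖v z‖ ^ 2 with hk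
  have hki : IntegrableOn k (Ioo (-Real.pi) Real.pi) := integrableOn_energy hh hvL
  have hkI : IntervalIntegrable k volume (-Real.pi) Real.pi := intervalIntegrable_cell_iff.2 hki
  have h0 : (0 : ℝ) ∈ Ioo (-Real.pi) Real.pi := ⟨by linarith [Real.pi_pos], Real.pi_pos⟩
  -- The right-hand side is defined up to the end points, unlike `(c_* - U_*) |v|²` itself.
  set E : ℝ → ℝ := fun z => speedGap 0 * ‖v 0‖ ^ 2 + ∫ t in (0 : ℝ)..z, k t with hE
  have hEc : ContinuousOn E (Icc (-Real.pi) Real.pi) := by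
    have := intervalIntegral.continuousOn_primitive_interval' hkI
      (a := 0) (by rw [uIcc_of_le neg_pi_le_pi]; exact Ioo_subset_Icc_self h0)
    rw [uIcc_of_le neg_pi_le_pi] at this
    exact continuousOn_const.add this
  have hEq : ∀ z ∈ Ioo (-Real.pi) Real.pi, E z = speedGap z * ‖v z‖ ^ 2 := by
    intro z hz
    rcases le_total 0 z with hz0 | hz0
    · have := ((hG.mono h0.1.le hz0 hz.2.le).integral_energy h0.1 hz0 hz.2 hv).2
      simp only [hE, hk, this]
      ring
    · have := ((hG.mono hz.1.le hz0 h0.2.le).integral_energy hz.1 hz0 h0.2 hv).2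
      simp only [hE, hk]
      rw [intervalIntegral.integral_symm, this]
      ring
  have hn : IntegrableOn (fun z => ‖v z‖ ^ 2) (Ioo (-Real.pi) Real.pi) :=
    hvL.integrable_norm_pow (by norm_num)
  have hend : ∀ e ∈ Icc (-Real.pi) Real.pi, e ^ 2 = Real.pi ^ 2 → E e = 0 := by
    intro e he he2
    by_contra hne
    obtain ⟨ε, hε, hεE⟩ := Metric.continuousWithinAt_iff.1 (hEc e he) (|E e| / 2)
      (half_pos (abs_pos.2 hne))
    have hsub : Ioo (max (-Real.pi) (e - ε)) (min Real.pi (e + ε)) ⊆ Ioo (-Real.pi) Real.pi :=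
      Ioo_subset_Ioo (le_max_left _ _) (min_le_left _ _)
    refine false_of_le_abs_sub_mul (n := fun z => Real.pi / 3 * ‖v z‖ ^ 2)
      (s := max (-Real.pi) (e - ε)) (t := min Real.pi (e + ε)) (e := e) (c := |E e| / 2)
      ?_ ?_ (half_pos (abs_pos.2 hne)) ((hn.mono_set hsub).const_mul _) ?_
    · rw [max_lt_iff, lt_min_iff, lt_min_iff]
      exact ⟨⟨by linarith [Real.pi_pos], by linarith [he.1]⟩, by linarith [he.2], by linarith⟩
    · exact ⟨max_le he.1 (by linarith), le_min he.2 (by linarith)⟩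
    · intro z hz
      have hzc := hsub hz
      have h1 : dist z e < ε := by
        rw [Real.dist_eq, abs_lt]
        constructor
        · linarith [le_max_right (-Real.pi) (e - ε), hz.1]
        · linarith [min_le_right Real.pi (e + ε), hz.2]
      have h2 := hεE (Ioo_subset_Icc_self hzc) h1
      rw [Real.dist_eq] at h2
      have h3 : |E e| / 2 ≤ |E z| := by
        have := abs_sub_abs_le_abs_sub (E e) (E z)
        rw [abs_sub_comm] at this
        linarith
      rw [hEq z hzc, abs_mul, abs_of_nonneg (sq_nonneg ‖v z‖)] at h3
      have h4 : |speedGap z| ≤ |z - e| * (Real.pi / 3) := by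
        have : speedGap z = (z - e) * (-(z + e) / 6) := by
          rw [speedGap, ← he2]
          ring
        rw [this, abs_mul]
        refine mul_le_mul_of_nonneg_left ?_ (abs_nonneg _)
        rw [abs_le]
        constructor <;> linarith [hzc.1, hzc.2, he.1, he.2]
      calc |E e| / 2 ≤ |speedGap z| * ‖v z‖ ^ 2 := h3
        _ ≤ |z - e| * (Real.pi / 3) * ‖v z‖ ^ 2 := by gcongr
        _ = |z - e| * (Real.pi / 3 * ‖v z‖ ^ 2) := by ring
  have hr : E Real.pi = 0 := hend _ (right_mem_Icc.2 neg_pi_le_pi) rfl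
  have hl : E (-Real.pi) = 0 := hend _ (left_mem_Icc.2 neg_pi_le_pi) (by ring)
  refine ⟨E, hEc, hEq, hl, hr, ?_⟩
  have hs : ∀ z ∈ Icc (-Real.pi) Real.pi, IntervalIntegrable k volume 0 z := fun z hz =>
    hkI.mono_set (by
      rw [uIcc_of_le neg_pi_le_pi]
      exact uIcc_subset_Icc (Ioo_subset_Icc_self h0) hz)
  rw [← integral_Ioc_eq_integral_Ioo, ← intervalIntegral.integral_of_le neg_pi_le_pi,
    ← intervalIntegral.integral_interval_sub_left
      (hs _ (right_mem_Icc.2 neg_pi_le_pi)) (hs _ (left_mem_Icc.2 neg_pi_le_pi))]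
  have : E Real.pi - E (-Real.pi) = 0 := by rw [hr, hl, sub_zero]
  simp only [hE] at this
  linarith

/-- A primitive of the form `(c_* - U_*) v` with square integrable `v` vanishes at the ends of the
period cell, since `|(c_* - U_*) v|²` is `c_* - U_*` times the energy, which has finite limits. -/
theorem IsPrimitiveOn.eq_zero_of_sq_eq {G h v : ℝ → ℂ}
    (hG : IsPrimitiveOn G h (-Real.pi) Real.pi)
    (hv : ∀ z ∈ Ioo (-Real.pi) Real.pi, G z = speedGap z * v z)
    (hh : MemLp h 2 (volume.restrict (Ioo (-Real.pi) Real.pi)))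
    (hvL : MemLp v 2 (volume.restrict (Ioo (-Real.pi) Real.pi))) :
    G (-Real.pi) = 0 ∧ G Real.pi = 0 := by
  obtain ⟨E, hEc, hE, -, -, -⟩ := hG.exists_energy_extension hv hh hvL
  have h : EqOn (fun z => ‖G z‖ ^ 2) (fun z => speedGap z * E z) (Icc (-Real.pi) Real.pi) := by
    refine EqOn.of_subset_closure (s := Ioo (-Real.pi) Real.pi) (fun z hz => ?_)
      (hG.continuousOn.norm.pow 2) (continuous_speedGap.continuousOn.mul hEc)
      Ioo_subset_Icc_self ?_
    · simp only [hv z hz, hE z hz, norm_mul, Complex.norm_real, Real.norm_eq_abs, mul_pow, sq_abs]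
      ring
    · rw [closure_Ioo (by linarith [Real.pi_pos] : -Real.pi < Real.pi).ne]
  have h1 := h (left_mem_Icc.2 neg_pi_le_pi)
  have h2 := h (right_mem_Icc.2 neg_pi_le_pi)
  simp only [speedGap, neg_sq, sub_self, zero_div, zero_mul] at h1 h2
  exact ⟨norm_eq_zero.1 (pow_eq_zero_iff two_ne_zero |>.1 h1),
    norm_eq_zero.1 (pow_eq_zero_iff two_ne_zero |>.1 h2)⟩

/-! ### The resolvent equation of the transport operator outside the strip -/

/-- The time `y(z)` in which the flow of `z' = c_* - U_*(z)` goes from `0` to `z`; it maps the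
period cell increasingly onto the real line. -/
noncomputable def travelTime (z : ℝ) : ℝ :=
  3 / Real.pi * (Real.log (Real.pi + z) - Real.log (Real.pi - z))

/-- The integrating factor `exp (-lam y(z))` of the equation `((c_* - U_*) v)' - lam v = f`. -/
noncomputable def integratingFactor (lam : ℂ) (z : ℝ) : ℂ := Complex.exp (-lam * travelTime z)

theorem hasDerivAt_travelTime {z : ℝ} (hz : z ∈ Ioo (-Real.pi) Real.pi) :
    HasDerivAt travelTime (speedGap z)⁻¹ z := by
  have h1 : Real.pi + z ≠ 0 := by linarith [hz.1]
  have h2 : Real.pi - z ≠ 0 := by linarith [hz.2]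
  have h := ((((hasDerivAt_id z).const_add Real.pi).log h1).sub
    (((hasDerivAt_id z).const_sub Real.pi).log h2)).const_mul (3 / Real.pi)
  convert! h using 1
  have h3 := (speedGap_pos hz).ne'
  have h4 : Real.pi ^ 2 - z ^ 2 ≠ 0 := by
    rw [show Real.pi ^ 2 - z ^ 2 = (Real.pi + z) * (Real.pi - z) by ring]
    exact mul_ne_zero h1 h2
  have h5 := Real.pi_ne_zero
  simp only [id]
  rw [speedGap]
  field_simp
  ring

theorem monotoneOn_travelTime : MonotoneOn travelTime (Ioo (-Real.pi) Real.pi) := by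
  intro x hx y hy hxy
  have h1 : Real.log (Real.pi + x) ≤ Real.log (Real.pi + y) :=
    Real.log_le_log (by linarith [hx.1]) (by linarith)
  have h2 : Real.log (Real.pi - y) ≤ Real.log (Real.pi - x) :=
    Real.log_le_log (by linarith [hy.2]) (by linarith)
  exact mul_le_mul_of_nonneg_left (by linarith) (by positivity)

theorem hasDerivAt_integratingFactor (lam : ℂ) {z : ℝ} (hz : z ∈ Ioo (-Real.pi) Real.pi) :
    HasDerivAt (integratingFactor lam)
      (integratingFactor lam z * (-lam * ((speedGap z)⁻¹ : ℝ))) z :=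
  ((hasDerivAt_travelTime hz).ofReal_comp.const_mul (-lam)).cexp

theorem norm_integratingFactor (lam : ℂ) (z : ℝ) :
    ‖integratingFactor lam z‖ = Real.exp (-lam.re * travelTime z) := by
  rw [integratingFactor, Complex.norm_exp]
  simp

theorem integratingFactor_neg_mul (lam : ℂ) (z : ℝ) :
    integratingFactor (-lam) z * integratingFactor lam z = 1 := by
  rw [integratingFactor, integratingFactor, ← Complex.exp_add]
  simp

theorem continuousOn_integratingFactor (lam : ℂ) :
    ContinuousOn (integratingFactor lam) (Ioo (-Real.pi) Real.pi) := fun _ hz =>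
  (hasDerivAt_integratingFactor lam hz).continuousAt.continuousWithinAt

theorem isPrimitiveOn_integratingFactor (lam : ℂ) {α β : ℝ} (hα : -Real.pi < α) (hαβ : α ≤ β)
    (hβ : β < Real.pi) : IsPrimitiveOn (integratingFactor lam)
      (fun z => integratingFactor lam z * (-lam * ((speedGap z)⁻¹ : ℝ))) α β := by
  have hs : Icc α β ⊆ Ioo (-Real.pi) Real.pi := Icc_subset_Ioo hα hβ
  refine .of_hasDerivAt hαβ (fun z hz => hasDerivAt_integratingFactor lam (hs hz)) ?_
  refine ((continuousOn_integratingFactor lam).mono hs).mul (continuousOn_const.mul ?_)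
  exact Complex.continuous_ofReal.comp_continuousOn (continuous_speedGap.continuousOn.inv₀
    fun z hz => (speedGap_pos (hs hz)).ne')

/-- The Cauchy–Schwarz inequality against the constant function. -/
theorem sq_integral_norm_le {f : ℝ → ℂ} {a b : ℝ} (hab : a < b)
    (hf : MemLp f 2 (volume.restrict (Ioo a b))) :
    (∫ x in Ioo a b, ‖f x‖) ^ 2 ≤ (b - a) * ∫ x in Ioo a b, ‖f x‖ ^ 2 := by
  have h1 : IntegrableOn (fun x => ‖f x‖) (Ioo a b) := (hf.integrable (by norm_num)).norm
  have h2 : IntegrableOn (fun x => ‖f x‖ ^ 2) (Ioo a b) := hf.integrable_norm_pow (by norm_num)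
  set I := ∫ x in Ioo a b, ‖f x‖
  set c := I / (b - a) with hc
  have hba : 0 < b - a := by linarith
  have h3 : 0 ≤ ∫ x in Ioo a b, (‖f x‖ - c) ^ 2 := integral_nonneg fun _ => sq_nonneg _
  have e : ∀ x, (‖f x‖ - c) ^ 2 = ‖f x‖ ^ 2 - (2 * c) * ‖f x‖ + c ^ 2 := fun x => by ring
  have h12 : IntegrableOn (fun x => ‖f x‖ ^ 2 - (2 * c) * ‖f x‖) (Ioo a b) :=
    h2.sub (h1.const_mul _)
  simp only [e] at h3
  rw [integral_add h12 (integrable_const _), integral_sub h2 (h1.const_mul _),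
    integral_const_mul, setIntegral_const, Real.volume_real_Ioo_of_le hab.le, smul_eq_mul] at h3
  have h4 : (b - a) * c = I := by rw [hc]; field_simp
  change 0 ≤ _ - 2 * c * I + _ at h3
  nlinarith

/-- For `Re lam > π / 6` the equation `((c_* - U_*) v)' - lam v = f` has a square integrable
solution: variation of constants from the right end point, with the bound that the energy
`(c_* - U_*) |v|²` gives on compact subintervals. -/
theorem exists_transport_resolvent_of_pos {lam : ℂ} (hlam : Real.pi / 6 < lam.re) {f : ℝ → ℂ}
    (hf : MemLp f 2 (volume.restrict (Ioo (-Real.pi) Real.pi))) :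
    ∃ v G : ℝ → ℂ, MemLp v 2 (volume.restrict (Ioo (-Real.pi) Real.pi)) ∧
      IsPrimitiveOn G (fun z => f z + lam * v z) (-Real.pi) Real.pi ∧
      ∀ z ∈ Ioo (-Real.pi) Real.pi, G z = speedGap z * v z := by
  have hpi := Real.pi_pos
  have hfi : IntegrableOn f (Ioo (-Real.pi) Real.pi) := hf.integrable (by norm_num)
  have hf2 : IntegrableOn (fun x => ‖f x‖ ^ 2) (Ioo (-Real.pi) Real.pi) :=
    hf.integrable_norm_pow (by norm_num)
  set N := ∫ x in Ioo (-Real.pi) Real.pi, ‖f x‖ ^ 2 with hN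
  have hN0 : 0 ≤ N := integral_nonneg fun _ => sq_nonneg _
  set δ := lam.re - Real.pi / 6 with hδ
  have hδ0 : 0 < δ := by linarith
  set ρ := integratingFactor lam
  have hρle : ∀ z ∈ Ioo (-Real.pi) Real.pi, ∀ t ∈ Ioo z Real.pi, ‖ρ t‖ ≤ ‖ρ z‖ := by
    intro z hz t ht
    rw [norm_integratingFactor, norm_integratingFactor, Real.exp_le_exp]
    have := monotoneOn_travelTime hz ⟨hz.1.trans ht.1, ht.2⟩ ht.1.le
    nlinarith
  have hρf : ∀ z ∈ Ioo (-Real.pi) Real.pi, IntervalIntegrable (fun t => ρ t * f t) volume z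
      Real.pi := by
    intro z hz
    have hsub : Ioo z Real.pi ⊆ Ioo (-Real.pi) Real.pi := Ioo_subset_Ioo_left hz.1.le
    rw [intervalIntegrable_iff_integrableOn_Ioc_of_le hz.2.le,
      integrableOn_Ioc_iff_integrableOn_Ioo]
    refine Integrable.bdd_mul (c := ‖ρ z‖) (hfi.mono_set hsub)
      (((continuousOn_integratingFactor lam).mono hsub).aestronglyMeasurable measurableSet_Ioo) ?_
    filter_upwards [ae_restrict_mem measurableSet_Ioo] with t ht
    exact hρle z hz t ht
  -- Variation of constants: `G = -ρ⁻¹ ∫_z^π ρ f`, where `ρ⁻¹` is the factor for `-lam`.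
  set Φ : ℝ → ℂ := fun z => -∫ t in z..Real.pi, ρ t * f t with hΦ
  set G : ℝ → ℂ := fun z => integratingFactor (-lam) z * Φ z with hG
  set v : ℝ → ℂ := fun z => G z / speedGap z with hvdef
  have hv : ∀ z ∈ Ioo (-Real.pi) Real.pi, G z = speedGap z * v z := by
    intro z hz
    have : (speedGap z : ℂ) ≠ 0 := by exact_mod_cast (speedGap_pos hz).ne'
    simp only [hvdef]
    field_simp
  have hGP : ∀ α β, -Real.pi < α → α ≤ β → β < Real.pi →
      IsPrimitiveOn G (fun z => f z + lam * v z) α β := by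
    intro α β hα hαβ hβ
    have hs : Icc α β ⊆ Ioo (-Real.pi) Real.pi := Icc_subset_Ioo hα hβ
    have hΦP : IsPrimitiveOn Φ (fun t => ρ t * f t) α β := by
      refine ⟨(hρf α ⟨hα, hαβ.trans_lt hβ⟩).mono_set ?_, fun x hx y hy => ?_⟩
      · rw [uIcc_of_le hαβ, uIcc_of_le (hαβ.trans hβ.le)]
        exact Icc_subset_Icc_right hβ.le
      · rw [← intervalIntegral.integral_add_adjacent_intervals (hρf x (hs hx))
          (hρf y (hs hy)).symm, intervalIntegral.integral_symm y]
        simp only [hΦ]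
        ring
    refine ((isPrimitiveOn_integratingFactor (-lam) hα hαβ hβ).mul hαβ hΦP).congr hαβ
      (fun _ _ => rfl) fun z hz => ?_
    have h1 := integratingFactor_neg_mul lam z
    simp only [hvdef, hG]
    rw [← mul_assoc (integratingFactor (-lam) z) (ρ z), h1]
    push_cast
    ring
  -- As `|ρ|` decreases, `|G z| ≤ ∫_z^π |f|`; so the energy stays bounded at the right end point.
  have hGbound : ∀ z ∈ Ioo (-Real.pi) Real.pi, ‖G z‖ ^ 2 ≤ (Real.pi - z) * N := by
    intro z hz
    have hsub : Ioo z Real.pi ⊆ Ioo (-Real.pi) Real.pi := Ioo_subset_Ioo_left hz.1.le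
    have h1 : ‖Φ z‖ ≤ ‖ρ z‖ * ∫ t in Ioo z Real.pi, ‖f t‖ := by
      rw [hΦ, norm_neg, intervalIntegral.integral_of_le hz.2.le, integral_Ioc_eq_integral_Ioo,
        ← integral_const_mul]
      refine norm_integral_le_of_norm_le ((hfi.mono_set hsub).norm.const_mul _) ?_
      filter_upwards [ae_restrict_mem measurableSet_Ioo] with t ht
      rw [norm_mul]
      exact mul_le_mul_of_nonneg_right (hρle z hz t ht) (norm_nonneg _)
    have h2 : ‖G z‖ ≤ ∫ t in Ioo z Real.pi, ‖f t‖ := by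
      have h3 : ‖integratingFactor (-lam) z‖ * ‖ρ z‖ = 1 := by
        rw [← norm_mul, integratingFactor_neg_mul, norm_one]
      calc ‖G z‖ = ‖integratingFactor (-lam) z‖ * ‖Φ z‖ := norm_mul _ _
        _ ≤ ‖integratingFactor (-lam) z‖ * (‖ρ z‖ * ∫ t in Ioo z Real.pi, ‖f t‖) := by gcongr
        _ = ∫ t in Ioo z Real.pi, ‖f t‖ := by rw [← mul_assoc, h3, one_mul]
    calc ‖G z‖ ^ 2 ≤ (∫ t in Ioo z Real.pi, ‖f t‖) ^ 2 := by gcongr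
      _ ≤ (Real.pi - z) * ∫ t in Ioo z Real.pi, ‖f t‖ ^ 2 :=
        sq_integral_norm_le hz.2 (hf.mono_measure (Measure.restrict_mono hsub le_rfl))
      _ ≤ (Real.pi - z) * N := by
        refine mul_le_mul_of_nonneg_left ?_ (by linarith [hz.2])
        exact setIntegral_mono_set hf2 (Eventually.of_forall fun _ => sq_nonneg _)
          hsub.eventuallyLE
  have hGc : ContinuousOn G (Ioo (-Real.pi) Real.pi) := by
    intro z hz
    obtain ⟨α, hα1, hα2⟩ := exists_between hz.1
    obtain ⟨β, hβ1, hβ2⟩ := exists_between hz.2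
    exact ((hGP α β hα1 (hα2.trans hβ1).le hβ2).continuousOn.continuousAt
      (Icc_mem_nhds hα2 hβ1)).continuousWithinAt
  have hvc : ContinuousOn v (Ioo (-Real.pi) Real.pi) :=
    hGc.div (Complex.continuous_ofReal.comp continuous_speedGap).continuousOn fun z hz => by
      exact_mod_cast (speedGap_pos hz).ne'
  -- The energy at `-b` enters with a favourable sign, so only its value at `b` has to be bounded.
  have hbound : ∀ b, 0 ≤ b → b < Real.pi →
      IntegrableOn (fun z => ‖v z‖ ^ 2) (Ioc (-b) b) ∧
      ∫ z in Ioc (-b) b, ‖v z‖ ^ 2 ≤ δ⁻¹ * (6 / Real.pi * N + δ⁻¹ * N) := by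
    intro b hb0 hb
    have hbb : -b ≤ b := by linarith
    have hs : Icc (-b) b ⊆ Ioo (-Real.pi) Real.pi := Icc_subset_Ioo (by linarith) hb
    have hvi : IntervalIntegrable (fun z => ‖v z‖ ^ 2) volume (-b) b :=
      ContinuousOn.intervalIntegrable (by
        rw [uIcc_of_le hbb]
        exact (hvc.mono hs).norm.pow 2)
    have hfi2 : IntervalIntegrable (fun z => ‖f z‖ ^ 2) volume (-b) b := by
      rw [intervalIntegrable_iff_integrableOn_Ioc_of_le hbb]
      exact hf2.mono_set (Ioc_subset_Icc_self.trans hs)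
    refine ⟨(intervalIntegrable_iff_integrableOn_Ioc_of_le hbb).1 hvi, ?_⟩
    obtain ⟨h1, h2⟩ := (hGP (-b) b (by linarith) hbb hb).integral_energy (by linarith) hbb hb hv
    have h3 : ∫ z in (-b)..b, (δ * ‖v z‖ ^ 2 - δ⁻¹ * ‖f z‖ ^ 2) ≤
        ∫ z in (-b)..b, (2 * ((f z + lam * v z) * (starRingEnd ℂ) (v z)).re +
          z / 3 * ‖v z‖ ^ 2) := by
      refine intervalIntegral.integral_mono_on hbb ((hvi.const_mul _).sub (hfi2.const_mul _)) h1
        fun z hz => ?_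
      have e1 : ((f z + lam * v z) * (starRingEnd ℂ) (v z)).re =
          (f z * (starRingEnd ℂ) (v z)).re + lam.re * ‖v z‖ ^ 2 := by
        rw [add_mul, mul_assoc, Complex.mul_conj', Complex.add_re]
        congr 1
        rw [← Complex.ofReal_pow, Complex.re_mul_ofReal]
      have e2 : -(‖f z‖ * ‖v z‖) ≤ (f z * (starRingEnd ℂ) (v z)).re := by
        have := Complex.abs_re_le_norm (f z * (starRingEnd ℂ) (v z))
        rw [norm_mul, RCLike.norm_conj] at this
        exact (abs_le.1 this).1
      have e3 : 2 * (‖f z‖ * ‖v z‖) ≤ δ * ‖v z‖ ^ 2 + δ⁻¹ * ‖f z‖ ^ 2 := by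
        have := sq_nonneg (δ * ‖v z‖ - ‖f z‖)
        rw [← sub_nonneg]
        have e : δ * ‖v z‖ ^ 2 + δ⁻¹ * ‖f z‖ ^ 2 - 2 * (‖f z‖ * ‖v z‖) =
            δ⁻¹ * (δ * ‖v z‖ - ‖f z‖) ^ 2 := by
          field_simp
          ring
        rw [e]
        positivity
      have e4 : 0 ≤ (z + Real.pi) / 3 * ‖v z‖ ^ 2 :=
        mul_nonneg (by linarith [(hs hz).1]) (sq_nonneg _)
      rw [e1]
      have e5 : lam.re * ‖v z‖ ^ 2 = δ * ‖v z‖ ^ 2 + Real.pi / 6 * ‖v z‖ ^ 2 := by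
        rw [hδ]
        ring
      linarith
    rw [h2, intervalIntegral.integral_sub (hvi.const_mul _) (hfi2.const_mul _),
      intervalIntegral.integral_const_mul, intervalIntegral.integral_const_mul] at h3
    have h4 : speedGap b * ‖v b‖ ^ 2 ≤ 6 / Real.pi * N := by
      have hbI : b ∈ Ioo (-Real.pi) Real.pi := hs ⟨hbb, le_rfl⟩
      have ha := speedGap_pos hbI
      have e : speedGap b * (speedGap b * ‖v b‖ ^ 2) = ‖G b‖ ^ 2 := by
        rw [hv b hbI, norm_mul, Complex.norm_real, Real.norm_of_nonneg ha.le]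
        ring
      have h5 := hGbound b hbI
      rw [← e] at h5
      have h6 : (Real.pi - b) * N ≤ speedGap b * (6 / Real.pi * N) := by
        have : speedGap b * (6 / Real.pi * N) = (Real.pi - b) * N * ((Real.pi + b) / Real.pi) := by
          rw [speedGap]
          field_simp
          ring
        rw [this]
        refine le_mul_of_one_le_right (mul_nonneg (by linarith) hN0) ?_
        rw [one_le_div hpi]
        linarith
      exact le_of_mul_le_mul_left (h5.trans h6) ha
    have h7 : 0 ≤ speedGap (-b) * ‖v (-b)‖ ^ 2 :=
      mul_nonneg (speedGap_pos (hs ⟨le_rfl, hbb⟩)).le (sq_nonneg _)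
    have h8 : ∫ z in (-b)..b, ‖f z‖ ^ 2 ≤ N := by
      rw [intervalIntegral.integral_of_le hbb]
      exact setIntegral_mono_set hf2 (Eventually.of_forall fun _ => sq_nonneg _)
        (Ioc_subset_Icc_self.trans hs).eventuallyLE
    have h9 : δ⁻¹ * (∫ z in (-b)..b, ‖f z‖ ^ 2) ≤ δ⁻¹ * N := by gcongr
    rw [← intervalIntegral.integral_of_le hbb, ← div_eq_inv_mul, le_div_iff₀ hδ0]
    linarith
  have hvL : MemLp v 2 (volume.restrict (Ioo (-Real.pi) Real.pi)) := by
    rw [memLp_two_iff_integrable_sq_norm (hvc.aestronglyMeasurable measurableSet_Ioo)]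
    have hb : ∀ n : ℕ, 0 ≤ Real.pi - Real.pi * (1 / ((n : ℝ) + 1)) ∧
        Real.pi - Real.pi * (1 / ((n : ℝ) + 1)) < Real.pi := by
      intro n
      have h1 : (1 : ℝ) / ((n : ℝ) + 1) ≤ 1 := by
        rw [div_le_one (by positivity)]
        linarith [Nat.cast_nonneg (α := ℝ) n]
      have h2 : (0 : ℝ) < 1 / ((n : ℝ) + 1) := by positivity
      constructor <;> nlinarith
    have ht : Tendsto (fun n : ℕ => Real.pi - Real.pi * (1 / ((n : ℝ) + 1))) atTop
        (𝓝 Real.pi) := by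
      simpa using tendsto_const_nhds.sub
        ((tendsto_one_div_add_atTop_nhds_zero_nat (𝕜 := ℝ)).const_mul Real.pi)
    have := integrableOn_Ioc_of_intervalIntegral_norm_bounded
      (I := δ⁻¹ * (6 / Real.pi * N + δ⁻¹ * N))
      (fun n => (hbound _ (hb n).1 (hb n).2).1) ht.neg ht (Eventually.of_forall fun n => by
        simpa only [norm_pow, norm_norm] using (hbound _ (hb n).1 (hb n).2).2)
    rwa [integrableOn_Ioc_iff_integrableOn_Ioo] at this
  have hh : MemLp (fun z => f z + lam * v z) 2 (volume.restrict (Ioo (-Real.pi) Real.pi)) :=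
    hf.add (hvL.const_mul lam)
  have hhI : IntervalIntegrable (fun z => f z + lam * v z) volume (-Real.pi) Real.pi :=
    intervalIntegrable_cell_iff.2 (hh.integrable (by norm_num))
  have h0 : (0 : ℝ) ∈ Ioo (-Real.pi) Real.pi := ⟨by linarith, hpi⟩
  have hs : ∀ z ∈ Icc (-Real.pi) Real.pi,
      IntervalIntegrable (fun z => f z + lam * v z) volume 0 z := fun z hz =>
    hhI.mono_set (by
      rw [uIcc_of_le neg_pi_le_pi]
      exact uIcc_subset_Icc (Ioo_subset_Icc_self h0) hz)
  -- Redefining `G` by its integral extends it continuously to the end points.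
  refine ⟨v, fun z => G 0 + ∫ t in (0 : ℝ)..z, (f t + lam * v t), hvL, ⟨hhI, fun x hx y hy => ?_⟩,
    fun z hz => ?_⟩
  · rw [← intervalIntegral.integral_interval_sub_left (hs y hy) (hs x hx)]
    ring
  · rw [← hv z hz]
    beta_reduce
    rcases le_total 0 z with hz0 | hz0
    · rw [(hGP 0 z h0.1 hz0 hz.2).2 0 ⟨le_rfl, hz0⟩ z ⟨hz0, le_rfl⟩]
      ring
    · rw [(hGP z 0 hz.1 hz0 h0.2).2 0 ⟨hz0, le_rfl⟩ z ⟨le_rfl, hz0⟩]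
      ring

theorem measurePreserving_neg_cell :
    MeasurePreserving (fun z : ℝ => -z) (volume.restrict (Ioo (-Real.pi) Real.pi))
      (volume.restrict (Ioo (-Real.pi) Real.pi)) := by
  have h := (Measure.measurePreserving_neg (volume : Measure ℝ)).restrict_preimage
    (measurableSet_Ioo (a := -Real.pi) (b := Real.pi))
  have e : (Neg.neg ⁻¹' Ioo (-Real.pi) Real.pi : Set ℝ) = Ioo (-Real.pi) Real.pi := by
    ext z
    simp only [mem_preimage, mem_Ioo]
    constructor <;> rintro ⟨h1, h2⟩ <;> constructor <;> linarith
  rwa [e] at h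

/-- For `|Re lam| > π / 6` the equation `((c_* - U_*) v)' - lam v = f` has a square integrable
solution. The reflection `z ↦ -z` exchanges `lam` and `-lam`. -/
theorem exists_transport_resolvent {lam : ℂ} (hlam : Real.pi / 6 < |lam.re|) {f : ℝ → ℂ}
    (hf : MemLp f 2 (volume.restrict (Ioo (-Real.pi) Real.pi))) :
    ∃ v G : ℝ → ℂ, MemLp v 2 (volume.restrict (Ioo (-Real.pi) Real.pi)) ∧
      IsPrimitiveOn G (fun z => f z + lam * v z) (-Real.pi) Real.pi ∧
      ∀ z ∈ Ioo (-Real.pi) Real.pi, G z = speedGap z * v z := by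
  rcases lt_abs.1 hlam with h | h
  · exact exists_transport_resolvent_of_pos h hf
  · obtain ⟨v, G, hv, hG, hGv⟩ := exists_transport_resolvent_of_pos (lam := -lam)
      (by simpa using h) (hf.comp_measurePreserving measurePreserving_neg_cell)
    refine ⟨fun z => -v (-z), fun z => -G (-z),
      (hv.comp_measurePreserving measurePreserving_neg_cell).neg, ?_, fun z hz => ?_⟩
    · have h1 := hG.comp_neg
      rw [neg_neg] at h1
      refine ⟨h1.1.neg.congr fun t _ => by simp, fun x hx y hy => ?_⟩
      have h2 := congrArg Neg.neg (h1.2 x hx y hy)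
      rw [← intervalIntegral.integral_neg] at h2
      rw [show -G (-y) - -G (-x) = -(G (-y) - G (-x)) by ring, ← h2]
      refine intervalIntegral.integral_congr fun t _ => ?_
      simp
    · change -G (-z) = speedGap z * -v (-z)
      rw [hGv (-z) ⟨by linarith [hz.2], by linarith [hz.1]⟩]
      simp [speedGap]

/-! ### The range of the transport operator inside the strip -/

theorem sq_norm_integratingFactor (lam : ℂ) {z : ℝ} (hz : z ∈ Ioo (-Real.pi) Real.pi) :
    ‖integratingFactor lam z‖ ^ 2 = (Real.pi - z) ^ (6 * lam.re / Real.pi) *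
      (Real.pi + z) ^ (-(6 * lam.re / Real.pi)) := by
  rw [norm_integratingFactor, Real.rpow_def_of_pos (by linarith [hz.2]),
    Real.rpow_def_of_pos (by linarith [hz.1]), ← Real.exp_add, ← Real.exp_nat_mul, travelTime]
  congr 1
  push_cast
  ring

theorem abs_exponent_lt_one {lam : ℂ} (hlam : |lam.re| < Real.pi / 6) :
    |6 * lam.re / Real.pi| < 1 := by
  rw [abs_div, abs_mul, abs_of_pos Real.pi_pos, div_lt_one Real.pi_pos, abs_of_pos (by norm_num)]
  linarith

/-- Both exponents `1 ± 6 Re lam / π` in `|ρ|² (c_* - U_*)` are positive inside the strip. -/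
theorem sq_norm_integratingFactor_mul_speedGap_le {lam : ℂ} (hlam : |lam.re| < Real.pi / 6) {z : ℝ}
    (hz : z ∈ Ioo (-Real.pi) Real.pi) :
    ‖integratingFactor lam z‖ ^ 2 * speedGap z ≤ (2 * Real.pi) ^ 2 / 6 := by
  have hp := abs_lt.1 (abs_exponent_lt_one hlam)
  rw [sq_norm_integratingFactor lam hz]
  set p := 6 * lam.re / Real.pi
  have h1 : 0 < Real.pi - z := by linarith [hz.2]
  have h2 : 0 < Real.pi + z := by linarith [hz.1]
  have h3 : 0 < 2 * Real.pi := by linarith [Real.pi_pos]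
  have e : (Real.pi - z) ^ p * (Real.pi + z) ^ (-p) * speedGap z =
      (Real.pi - z) ^ (p + 1) * (Real.pi + z) ^ (-p + 1) / 6 := by
    rw [Real.rpow_add_one h1.ne', Real.rpow_add_one h2.ne', speedGap]
    ring
  have h4 : (2 * Real.pi) ^ 2 = (2 * Real.pi) ^ (p + 1) * (2 * Real.pi) ^ (-p + 1) := by
    rw [← Real.rpow_add h3, ← Real.rpow_natCast]
    congr 1
    push_cast
    ring
  rw [e, h4]
  have h5 : (Real.pi - z) ^ (p + 1) ≤ (2 * Real.pi) ^ (p + 1) :=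
    Real.rpow_le_rpow h1.le (by linarith [hz.1]) (by linarith)
  have h6 : (Real.pi + z) ^ (-p + 1) ≤ (2 * Real.pi) ^ (-p + 1) :=
    Real.rpow_le_rpow h2.le (by linarith [hz.2]) (by linarith)
  have := mul_le_mul h5 h6 (by positivity) (by positivity)
  linarith

/-- Inside the strip the integrating factor is square integrable. -/
theorem memLp_integratingFactor {lam : ℂ} (hlam : |lam.re| < Real.pi / 6) :
    MemLp (integratingFactor lam) 2 (volume.restrict (Ioo (-Real.pi) Real.pi)) := by
  have hp := abs_lt.1 (abs_exponent_lt_one hlam)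
  have hm : AEStronglyMeasurable (integratingFactor lam)
      (volume.restrict (Ioo (-Real.pi) Real.pi)) :=
    (continuousOn_integratingFactor lam).aestronglyMeasurable measurableSet_Ioo
  rw [memLp_two_iff_integrable_sq_norm hm]
  set p := 6 * lam.re / Real.pi with hpdef
  have i1 : ∀ r : ℝ, -1 < r → IntegrableOn (fun z => (Real.pi + z) ^ r)
      (Ioo (-Real.pi) Real.pi) := by
    intro r hr
    rw [← intervalIntegrable_cell_iff]
    have := (intervalIntegral.intervalIntegrable_rpow' (a := 0) (b := 2 * Real.pi)
      hr).comp_add_right Real.pi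
    rw [zero_sub, show 2 * Real.pi - Real.pi = Real.pi by ring] at this
    simpa only [add_comm] using this
  have i2 : ∀ r : ℝ, -1 < r → IntegrableOn (fun z => (Real.pi - z) ^ r)
      (Ioo (-Real.pi) Real.pi) := by
    intro r hr
    rw [← intervalIntegrable_cell_iff]
    have := (intervalIntegral.intervalIntegrable_rpow' (a := 0) (b := 2 * Real.pi)
      hr).comp_sub_left Real.pi
    rw [sub_zero, show Real.pi - 2 * Real.pi = -Real.pi by ring] at this
    exact this.symm
  have hle : ∀ z ∈ Ioo (-Real.pi) Real.pi, 0 < Real.pi - z ∧ Real.pi - z ≤ 2 * Real.pi ∧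
      0 < Real.pi + z ∧ Real.pi + z ≤ 2 * Real.pi := fun z hz =>
    ⟨by linarith [hz.2], by linarith [hz.1], by linarith [hz.1], by linarith [hz.2]⟩
  rcases le_total 0 p with h0 | h0
  · refine ((i1 (-p) (by linarith)).const_mul ((2 * Real.pi) ^ p)).mono' (hm.norm.pow 2) ?_
    filter_upwards [ae_restrict_mem measurableSet_Ioo] with z hz
    obtain ⟨h1, h2, h3, h4⟩ := hle z hz
    rw [norm_pow, norm_norm, sq_norm_integratingFactor lam hz]
    exact mul_le_mul_of_nonneg_right (Real.rpow_le_rpow h1.le h2 h0) (by positivity)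
  · refine ((i2 p (by linarith)).mul_const ((2 * Real.pi) ^ (-p))).mono' (hm.norm.pow 2) ?_
    filter_upwards [ae_restrict_mem measurableSet_Ioo] with z hz
    obtain ⟨h1, h2, h3, h4⟩ := hle z hz
    rw [norm_pow, norm_norm, sq_norm_integratingFactor lam hz]
    exact mul_le_mul_of_nonneg_left (Real.rpow_le_rpow h3.le h4 (by linarith)) (by positivity)

/-- Inside the strip, a square integrable solution of `((c_* - U_*) v)' - lam v = f` satisfies
`ρ (c_* - U_*) v = -∫_z^π ρ f` with the integrating factor `ρ`, and `f` is orthogonal to `ρ̄`: the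
product `ρ (c_* - U_*) v` vanishes at both end points, since `|ρ|² (c_* - U_*)` is bounded and the
energy `(c_* - U_*) |v|²` vanishes there. -/
theorem IsPrimitiveOn.integratingFactor_mul {lam : ℂ} (hlam : |lam.re| < Real.pi / 6)
    {f v G : ℝ → ℂ} (hf : MemLp f 2 (volume.restrict (Ioo (-Real.pi) Real.pi)))
    (hvL : MemLp v 2 (volume.restrict (Ioo (-Real.pi) Real.pi)))
    (hG : IsPrimitiveOn G (fun z => f z + lam * v z) (-Real.pi) Real.pi)
    (hv : ∀ z ∈ Ioo (-Real.pi) Real.pi, G z = speedGap z * v z) :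
    (∀ z ∈ Ioo (-Real.pi) Real.pi, integratingFactor lam z * G z =
      -∫ t in z..Real.pi, integratingFactor lam t * f t) ∧
      ∫ z in Ioo (-Real.pi) Real.pi, integratingFactor lam z * f z = 0 := by
  set ρ := integratingFactor lam
  obtain ⟨E, hEc, hE, hEl, hEr, -⟩ := hG.exists_energy_extension hv
    (hf.add (hvL.const_mul lam)) hvL
  have hρf : IntervalIntegrable (fun t => ρ t * f t) volume (-Real.pi) Real.pi :=
    intervalIntegrable_cell_iff.2 ((memLp_integratingFactor hlam).integrable_mul hf)
  have h0 : (0 : ℝ) ∈ Ioo (-Real.pi) Real.pi := ⟨by linarith [Real.pi_pos], Real.pi_pos⟩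
  have hs : ∀ x ∈ Icc (-Real.pi) Real.pi, ∀ y ∈ Icc (-Real.pi) Real.pi,
      IntervalIntegrable (fun t => ρ t * f t) volume x y := fun x hx y hy =>
    hρf.mono_set (by
      rw [uIcc_of_le neg_pi_le_pi]
      exact uIcc_subset_Icc hx hy)
  have hloc : ∀ α β, -Real.pi < α → α ≤ β → β < Real.pi →
      ∫ t in α..β, ρ t * f t = ρ β * G β - ρ α * G α := by
    intro α β hα hαβ hβ
    have hP : IsPrimitiveOn (fun z => ρ z * G z) (fun z => ρ z * f z) α β := by
      refine ((isPrimitiveOn_integratingFactor lam hα hαβ hβ).mul hαβ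
        (hG.mono hα.le hαβ hβ.le)).congr hαβ (fun _ _ => rfl) fun z hz => ?_
      have hz' : z ∈ Ioo (-Real.pi) Real.pi := ⟨hα.trans hz.1, hz.2.trans hβ⟩
      have : (speedGap z : ℂ) ≠ 0 := by exact_mod_cast (speedGap_pos hz').ne'
      simp only [hv z hz']
      push_cast
      field_simp
      ring
    exact hP.2 α ⟨le_rfl, hαβ⟩ β ⟨hαβ, le_rfl⟩
  set P : ℝ → ℂ := fun z => ρ 0 * G 0 + ∫ t in (0 : ℝ)..z, ρ t * f t with hPdef
  have hPc : ContinuousOn P (Icc (-Real.pi) Real.pi) := by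
    have := intervalIntegral.continuousOn_primitive_interval' hρf
      (a := 0) (by rw [uIcc_of_le neg_pi_le_pi]; exact Ioo_subset_Icc_self h0)
    rw [uIcc_of_le neg_pi_le_pi] at this
    exact continuousOn_const.add this
  have hP : ∀ z ∈ Ioo (-Real.pi) Real.pi, P z = ρ z * G z := by
    intro z hz
    simp only [hPdef]
    rcases le_total 0 z with hz0 | hz0
    · rw [hloc 0 z h0.1 hz0 hz.2]
      ring
    · rw [intervalIntegral.integral_symm, hloc z 0 hz.1 hz0 h0.2]
      ring
  have hcl : closure (Ioo (-Real.pi) Real.pi) = Icc (-Real.pi) Real.pi :=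
    closure_Ioo (by linarith [Real.pi_pos] : -Real.pi < Real.pi).ne
  have hPE : ∀ z ∈ Icc (-Real.pi) Real.pi, ‖P z‖ ^ 2 ≤ (2 * Real.pi) ^ 2 / 6 * E z := by
    intro z hz
    rw [← hcl] at hz
    refine le_on_closure (s := Ioo (-Real.pi) Real.pi) (f := fun z => ‖P z‖ ^ 2)
      (g := fun z => (2 * Real.pi) ^ 2 / 6 * E z) (fun x hx => ?_) ?_ ?_ hz
    · have h1 := sq_norm_integratingFactor_mul_speedGap_le hlam hx
      have h2 : ‖P x‖ ^ 2 = ‖ρ x‖ ^ 2 * speedGap x * E x := by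
        rw [hP x hx, hv x hx, hE x hx, norm_mul, norm_mul, Complex.norm_real,
          Real.norm_of_nonneg (speedGap_pos hx).le]
        ring
      simp only [h2]
      refine mul_le_mul_of_nonneg_right h1 ?_
      rw [hE x hx]
      exact mul_nonneg (speedGap_pos hx).le (sq_nonneg _)
    · rw [hcl]
      exact hPc.norm.pow 2
    · rw [hcl]
      exact continuousOn_const.mul hEc
  have hz : ∀ e ∈ Icc (-Real.pi) Real.pi, E e = 0 → P e = 0 := by
    intro e he h
    have := hPE e he
    rw [h, mul_zero] at this
    exact norm_eq_zero.1 (pow_eq_zero_iff two_ne_zero |>.1 (le_antisymm this (sq_nonneg _)))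
  have hr := hz _ (right_mem_Icc.2 neg_pi_le_pi) hEr
  have hl := hz _ (left_mem_Icc.2 neg_pi_le_pi) hEl
  have h0' := Ioo_subset_Icc_self h0
  have hdiff : ∀ x ∈ Icc (-Real.pi) Real.pi, ∫ t in x..Real.pi, ρ t * f t = -P x := by
    intro x hx
    rw [← intervalIntegral.integral_interval_sub_left
      (hs 0 h0' _ (right_mem_Icc.2 neg_pi_le_pi)) (hs 0 h0' x hx)]
    have : P Real.pi - P x = -P x := by rw [hr, zero_sub]
    rw [← this]
    simp only [hPdef]
    ring
  refine ⟨fun z hz => ?_, ?_⟩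
  · rw [hdiff z (Ioo_subset_Icc_self hz), neg_neg, hP z hz]
  · rw [integral_cell, hdiff _ (left_mem_Icc.2 neg_pi_le_pi), hl, neg_zero]

theorem integratingFactor_ne_zero (lam : ℂ) (z : ℝ) : integratingFactor lam z ≠ 0 :=
  Complex.exp_ne_zero _

/-- Inside the strip the transport operator has no eigenvalues. -/
theorem IsPrimitiveOn.eq_zero_of_eigen {lam : ℂ} (hlam : |lam.re| < Real.pi / 6)
    {v G : ℝ → ℂ} (hvL : MemLp v 2 (volume.restrict (Ioo (-Real.pi) Real.pi)))
    (hG : IsPrimitiveOn G (fun z => lam * v z) (-Real.pi) Real.pi)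
    (hv : ∀ z ∈ Ioo (-Real.pi) Real.pi, G z = speedGap z * v z) :
    ∀ z ∈ Ioo (-Real.pi) Real.pi, v z = 0 := by
  intro z hz
  have h := (IsPrimitiveOn.integratingFactor_mul (f := fun _ => 0) hlam MemLp.zero' hvL
    (by simpa using hG) hv).1 z hz
  simp only [mul_zero, intervalIntegral.integral_zero, neg_zero, hv z hz] at h
  have h1 : (speedGap z : ℂ) ≠ 0 := by exact_mod_cast (speedGap_pos hz).ne'
  simpa [integratingFactor_ne_zero, h1] using h

/-- For `lam ≠ 0` the integrating factor is not constant, hence not orthogonal to all functions with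
zero mean. -/
theorem exists_integral_integratingFactor_mul_ne_zero {lam : ℂ} (hlam : |lam.re| < Real.pi / 6)
    (h0 : lam ≠ 0) : ∃ f : ℝ → ℂ, MemLp f 2 (volume.restrict (Ioo (-Real.pi) Real.pi)) ∧
      ∫ z in Ioo (-Real.pi) Real.pi, f z = 0 ∧
      ∫ z in Ioo (-Real.pi) Real.pi, integratingFactor lam z * f z ≠ 0 := by
  have hpi : ((2 * Real.pi : ℝ) : ℂ) ≠ 0 := by
    exact_mod_cast (by positivity : (2 * Real.pi : ℝ) ≠ 0)
  set ρ := integratingFactor lam with hρ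
  have hρL : MemLp ρ 2 (volume.restrict (Ioo (-Real.pi) Real.pi)) := memLp_integratingFactor hlam
  set m : ℂ := ((2 * Real.pi : ℝ) : ℂ)⁻¹ * ∫ z in Ioo (-Real.pi) Real.pi, ρ z with hm
  have hL : MemLp (fun z => ρ z - m) 2 (volume.restrict (Ioo (-Real.pi) Real.pi)) :=
    hρL.sub (memLp_const _)
  have hmean : ∫ z in Ioo (-Real.pi) Real.pi, (ρ z - m) = 0 := by
    rw [integral_sub (hρL.integrable (by norm_num)) (integrable_const _), setIntegral_const,
      Real.volume_real_Ioo_of_le neg_pi_le_pi, show Real.pi - -Real.pi = 2 * Real.pi by ring,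
      Complex.real_smul, hm, mul_inv_cancel_left₀ hpi, sub_self]
  have hfL : MemLp (fun z => (starRingEnd ℂ) (ρ z - m)) 2
      (volume.restrict (Ioo (-Real.pi) Real.pi)) := hL.star
  have hf0 : ∫ z in Ioo (-Real.pi) Real.pi, (starRingEnd ℂ) (ρ z - m) = 0 := by
    rw [integral_conj, hmean, map_zero]
  -- With `f = conj (ρ - m)`, where `m` is the mean of `ρ`, the integral of `ρ f` is `‖ρ - m‖²`.
  refine ⟨fun z => (starRingEnd ℂ) (ρ z - m), hfL, hf0, fun h => ?_⟩
  have e : ∀ z, ρ z * (starRingEnd ℂ) (ρ z - m) =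
      ((‖ρ z - m‖ ^ 2 : ℝ) : ℂ) + m * (starRingEnd ℂ) (ρ z - m) := by
    intro z
    push_cast
    rw [← Complex.mul_conj']
    ring
  have hsq : IntegrableOn (fun z => ‖ρ z - m‖ ^ 2) (Ioo (-Real.pi) Real.pi) :=
    hL.integrable_norm_pow (by norm_num)
  have hsqC : IntegrableOn (fun z => ((‖ρ z - m‖ ^ 2 : ℝ) : ℂ)) (Ioo (-Real.pi) Real.pi) :=
    hsq.ofReal
  simp only [e] at h
  rw [integral_add hsqC ((hfL.integrable (by norm_num)).const_mul m), integral_const_mul,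
    hf0, mul_zero, add_zero, integral_complex_ofReal, Complex.ofReal_eq_zero,
    integral_eq_zero_iff_of_nonneg (fun _ => sq_nonneg _) hsq] at h
  have hconst : EqOn ρ (fun _ => m) (Ioo (-Real.pi) Real.pi) := by
    refine Measure.eqOn_open_of_ae_eq (μ := volume) ?_ isOpen_Ioo
      (continuousOn_integratingFactor lam) continuousOn_const
    filter_upwards [h] with z hz
    simp only [Pi.zero_apply, ne_eq, OfNat.ofNat_ne_zero, not_false_eq_true, pow_eq_zero_iff,
      norm_eq_zero] at hz
    exact sub_eq_zero.1 hz
  have hz0 : (0 : ℝ) ∈ Ioo (-Real.pi) Real.pi := ⟨by linarith [Real.pi_pos], Real.pi_pos⟩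
  have hd := hasDerivAt_integratingFactor lam hz0
  have hd' : HasDerivAt ρ 0 0 := (hasDerivAt_const (0 : ℝ) m).congr_of_eventuallyEq
    (hconst.eventuallyEq_of_mem (Ioo_mem_nhds hz0.1 hz0.2))
  have hu := hd.unique hd'
  have h1 : ((speedGap 0)⁻¹ : ℝ) ≠ 0 := inv_ne_zero (speedGap_pos hz0).ne'
  have h2 : (((speedGap 0)⁻¹ : ℝ) : ℂ) ≠ 0 := by exact_mod_cast h1
  exact mul_ne_zero (integratingFactor_ne_zero lam 0) (mul_ne_zero (neg_ne_zero.2 h0) h2) hu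

/-! ### Perturbation theory of unbounded operators -/

section Abstract

variable {E : Type*} [NormedAddCommGroup E] [NormedSpace ℂ E]

theorem exists_continuous_inverse {D : Submodule ℂ E} {T : D →ₗ[ℂ] E}
    (hT : Function.Surjective T) {C : ℝ} (hC0 : 0 ≤ C) (hC : ∀ v : D, ‖(v : E)‖ ≤ C * ‖T v‖) :
    ∃ S : E →L[ℂ] E, ‖S‖ ≤ C ∧ ∀ w, ∃ v : D, (v : E) = S w ∧ T v = w := by
  have hinj : Function.Injective T := by
    rw [← LinearMap.ker_eq_bot, LinearMap.ker_eq_bot']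
    intro v hv
    have := hC v
    rw [hv, norm_zero, mul_zero] at this
    exact Subtype.ext (norm_le_zero_iff.1 this)
  set e := LinearEquiv.ofBijective T ⟨hinj, hT⟩
  have he : ∀ w, T (e.symm w) = w := fun w => e.apply_symm_apply w
  refine ⟨(D.subtype ∘ₗ e.symm.toLinearMap).mkContinuous C fun w => ?_,
    LinearMap.mkContinuous_norm_le _ hC0 _, fun w => ⟨e.symm w, rfl, he w⟩⟩
  have := hC (e.symm w)
  rwa [he] at this

/-- Surjectivity of an operator that is bounded below is stable under small bounded
perturbations. -/
theorem surjective_add_of_norm_lt [CompleteSpace E] {D : Submodule ℂ E} {T : D →ₗ[ℂ] E}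
    (hT : Function.Surjective T) {C : ℝ} (hC0 : 0 ≤ C) (hC : ∀ v : D, ‖(v : E)‖ ≤ C * ‖T v‖)
    (B : E →L[ℂ] E) (hB : C * ‖B‖ < 1) (w : E) : ∃ v : D, T v + B v = w := by
  obtain ⟨S, hS, hSv⟩ := exists_continuous_inverse hT hC0 hC
  have hn : ‖-(B * S)‖ < 1 := by
    rw [norm_neg]
    calc ‖B * S‖ ≤ ‖B‖ * ‖S‖ := norm_mul_le _ _
      _ ≤ ‖B‖ * C := by gcongr
      _ < 1 := by rwa [mul_comm]
  set U := Units.oneSub (-(B * S)) hn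
  obtain ⟨v, hv, hTv⟩ := hSv ((↑U⁻¹ : E →L[ℂ] E) w)
  refine ⟨v, ?_⟩
  have h : ((U : E →L[ℂ] E) * (↑U⁻¹ : E →L[ℂ] E)) w = w := by
    rw [Units.mul_inv]
    rfl
  rw [Units.val_oneSub, sub_neg_eq_add] at h
  rw [hTv, hv]
  exact h

theorem mem_resolventSet_of_bound {A : E →ₗ.[ℂ] E} {lam : ℂ} {C : ℝ}
    (hC : ∀ v : A.domain, ‖(v : E)‖ ≤ C * ‖A v - lam • (v : E)‖)
    (hsurj : ∀ w : E, ∃ v : A.domain, A v - lam • (v : E) = w) : lam ∈ resolventSet A := by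
  refine ⟨fun v hv => ?_, hsurj, C, hC⟩
  have := hC v
  rw [hv, norm_zero, mul_zero] at this
  exact norm_le_zero_iff.1 this

theorem exists_pos_bound_of_mem_resolventSet {A : E →ₗ.[ℂ] E} {lam : ℂ}
    (h : lam ∈ resolventSet A) :
    ∃ C : ℝ, 0 < C ∧ ∀ v : A.domain, ‖(v : E)‖ ≤ C * ‖A v - lam • (v : E)‖ := by
  obtain ⟨-, -, C, hC⟩ := h
  exact ⟨max C 1, by positivity, fun v => (hC v).trans (by gcongr; exact le_max_left _ _)⟩

theorem isOpen_resolventSet [CompleteSpace E] (A : E →ₗ.[ℂ] E) : IsOpen (resolventSet A) := by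
  rw [Metric.isOpen_iff]
  intro lam hlam
  obtain ⟨C, hC0, hC⟩ := exists_pos_bound_of_mem_resolventSet hlam
  refine ⟨C⁻¹, inv_pos.2 hC0, fun mu hmu => ?_⟩
  have hd : C * ‖lam - mu‖ < 1 := by
    rw [Metric.mem_ball, dist_comm, dist_eq_norm] at hmu
    exact (mul_lt_mul_of_pos_left hmu hC0).trans_eq (mul_inv_cancel₀ hC0.ne')
  have e : ∀ v : A.domain, A v - mu • (v : E) = A v - lam • (v : E) + (lam - mu) • (v : E) := by
    intro v
    module
  refine mem_resolventSet_of_bound (C := C / (1 - C * ‖lam - mu‖)) (fun v => ?_) fun w => ?_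
  · have h1 : ‖A v - lam • (v : E)‖ ≤ ‖A v - mu • (v : E)‖ + ‖lam - mu‖ * ‖(v : E)‖ := by
      rw [← norm_smul, e v]
      exact norm_le_add_norm_add _ _
    have h2 := (hC v).trans (mul_le_mul_of_nonneg_left h1 hC0.le)
    rw [div_mul_eq_mul_div, le_div_iff₀ (by linarith)]
    linarith
  · have hn : ‖(lam - mu) • ContinuousLinearMap.id ℂ E‖ ≤ ‖lam - mu‖ := by
      rw [norm_smul]
      exact mul_le_of_le_one_right (norm_nonneg _) ContinuousLinearMap.norm_id_le
    obtain ⟨v, hv⟩ := surjective_add_of_norm_lt (T := A.toFun - lam • A.domain.subtype)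
      (fun w => hlam.2.1 w) hC0.le hC ((lam - mu) • ContinuousLinearMap.id ℂ E)
      ((mul_le_mul_of_nonneg_left hn hC0.le).trans_lt hd) w
    exact ⟨v, (e v).trans hv⟩

/-- If `lam` is in the resolvent set of a compact perturbation `K + A₀` and `A₀ - lam` is injective,
then `A₀ - lam` is surjective: on the range side, `(A₀ - lam) (K + A₀ - lam)⁻¹` is an injective
compact perturbation of the identity. -/
theorem surjective_of_mem_resolventSet_vadd [CompleteSpace E] {A₀ : E →ₗ.[ℂ] E} {K : E →ₗ[ℂ] E}
    (hK : IsCompactOperator K) {lam : ℂ} (hlam : lam ∈ resolventSet (K +ᵥ A₀))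
    (hinj : ∀ v : A₀.domain, A₀ v - lam • (v : E) = 0 → (v : E) = 0) (w : E) :
    ∃ v : A₀.domain, A₀ v - lam • (v : E) = w := by
  obtain ⟨C, hC0, hC⟩ := exists_pos_bound_of_mem_resolventSet hlam
  obtain ⟨S, -, hS⟩ := exists_continuous_inverse
    (T := (K +ᵥ A₀).toFun - lam • (K +ᵥ A₀).domain.subtype) (fun w => hlam.2.1 w) hC0.le hC
  have hS' : ∀ u, ∃ v : A₀.domain, (v : E) = S u ∧ A₀ v - lam • (v : E) = u - K (S u) := by
    intro u
    obtain ⟨v, hv, hTv⟩ := hS u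
    refine ⟨v, hv, ?_⟩
    have h1 : K v + A₀ v - lam • (v : E) = u := hTv
    rw [← hv, ← h1]
    abel
  set Kc : E →L[ℂ] E := ⟨K, hK.continuous⟩
  have hT : IsCompactOperator (Kc * S) := hK.comp_clm S
  have hres : (1 : ℂ) ∈ _root_.resolventSet ℂ (Kc * S) := by
    refine (hT.hasEigenvalue_or_mem_resolventSet one_ne_zero).resolve_left fun hev => ?_
    obtain ⟨u, hu⟩ := hev.exists_hasEigenvector
    have h1 : K (S u) = u := hu.apply_eq_smul.trans (one_smul ℂ u)
    obtain ⟨v, hv, hAv⟩ := hS' u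
    have h2 : (v : E) = 0 := hinj v (by rw [hAv, h1, sub_self])
    rw [← hv, h2, map_zero] at h1
    exact hu.2 h1.symm
  rw [_root_.spectrum.mem_resolventSet_iff, map_one] at hres
  obtain ⟨U, hU⟩ := hres
  have h : ((U : E →L[ℂ] E) * (↑U⁻¹ : E →L[ℂ] E)) w = w := by
    rw [Units.mul_inv]
    rfl
  rw [hU] at h
  obtain ⟨v, -, hAv⟩ := hS' ((↑U⁻¹ : E →L[ℂ] E) w)
  exact ⟨v, hAv.trans h⟩

end Abstract

section Skew

variable {H : Type*} [NormedAddCommGroup H] [InnerProductSpace ℂ H] {A₀ : H →ₗ.[ℂ] H}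
  {K : H →L[ℂ] H} {b : ℝ}

/-- If the numerical range of `A₀` lies in the strip `|Re lam| ≤ b` and `K` is skew-adjoint, then
outside the strip `A₀ + t K - lam` is bounded below, uniformly in the real parameter `t`. -/
theorem mul_norm_le_norm_add_smul_skew (hK : ∀ v, (inner ℂ v (K v)).re = 0)
    (hA : ∀ u : A₀.domain, |(inner ℂ (u : H) (A₀ u)).re| ≤ b * ‖(u : H)‖ ^ 2) (lam : ℂ) (t : ℝ)
    (u : A₀.domain) :
    (|lam.re| - b) * ‖(u : H)‖ ≤ ‖A₀ u - lam • (u : H) + (t : ℂ) • K u‖ := by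
  set w := A₀ u - lam • (u : H) + (t : ℂ) • K u with hw
  rcases (norm_nonneg (u : H)).eq_or_lt with h0 | h0
  · rw [← h0, mul_zero]
    exact norm_nonneg _
  have h1 : (inner ℂ (u : H) w).re = (inner ℂ (u : H) (A₀ u)).re - lam.re * ‖(u : H)‖ ^ 2 := by
    rw [hw, inner_add_right, inner_sub_right, inner_smul_right, inner_smul_right, Complex.add_re,
      Complex.sub_re, Complex.re_ofReal_mul, hK, inner_self_eq_norm_sq_to_K, mul_zero, add_zero]
    congr 1
    rw [← RCLike.ofReal_pow]
    exact Complex.re_mul_ofReal _ _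
  have h3 : |(inner ℂ (u : H) w).re| ≤ ‖(u : H)‖ * ‖w‖ :=
    (Complex.abs_re_le_norm _).trans (norm_inner_le_norm _ _)
  have h4 : |lam.re| * ‖(u : H)‖ ^ 2 ≤ |(inner ℂ (u : H) w).re| +
      |(inner ℂ (u : H) (A₀ u)).re| := by
    rw [← abs_of_nonneg (sq_nonneg ‖(u : H)‖), ← abs_mul,
      show lam.re * ‖(u : H)‖ ^ 2 = (inner ℂ (u : H) (A₀ u)).re - (inner ℂ (u : H) w).re by
        rw [h1]; ring, add_comm]
    exact abs_sub _ _
  refine le_of_mul_le_mul_left ?_ h0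
  linarith [hA u]

/-- If the numerical range of `A₀` lies in the strip `|Re lam| ≤ b`, then surjectivity of `A₀ - lam`
outside the strip is inherited by `K + A₀ - lam` for bounded skew-adjoint `K`: it passes from
`A₀ + t K - lam` at `t = 0` to `t = 1` in finitely many equal steps. -/
theorem mem_resolventSet_vadd_of_skew [CompleteSpace H] (hK : ∀ v, (inner ℂ v (K v)).re = 0)
    (hA : ∀ u : A₀.domain, |(inner ℂ (u : H) (A₀ u)).re| ≤ b * ‖(u : H)‖ ^ 2) {lam : ℂ}
    (hlam : b < |lam.re|) (hA₀ : ∀ f : H, ∃ u : A₀.domain, A₀ u - lam • (u : H) = f) :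
    lam ∈ resolventSet ((K : H →ₗ[ℂ] H) +ᵥ A₀) := by
  set δ := |lam.re| - b with hδdef
  have hδ : 0 < δ := by linarith
  obtain ⟨n, hn⟩ := exists_nat_gt (δ⁻¹ * ‖K‖)
  have hn0 : (0 : ℝ) < n := lt_of_le_of_lt (by positivity) hn
  let T : ℝ → A₀.domain →ₗ[ℂ] H := fun t =>
    A₀.toFun - lam • A₀.domain.subtype + (t : ℂ) • ((K : H →ₗ[ℂ] H) ∘ₗ A₀.domain.subtype)
  have hT : ∀ (t : ℝ) (u : A₀.domain), T t u = A₀ u - lam • (u : H) + (t : ℂ) • K u :=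
    fun _ _ => rfl
  have hbelow : ∀ (t : ℝ) (u : A₀.domain), ‖(u : H)‖ ≤ δ⁻¹ * ‖T t u‖ := by
    intro t u
    rw [← div_eq_inv_mul, le_div_iff₀ hδ, mul_comm, hT]
    exact mul_norm_le_norm_add_smul_skew hK hA lam t u
  have hsurj : ∀ k : ℕ, Function.Surjective (T (k / n)) := by
    intro k
    induction k with
    | zero =>
      intro f
      obtain ⟨u, hu⟩ := hA₀ f
      refine ⟨u, ?_⟩
      rw [hT, ← hu]
      simp
    | succ k ih =>
      intro f
      have hB : δ⁻¹ * ‖((1 / n : ℝ) : ℂ) • K‖ < 1 := by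
        rw [norm_smul, Complex.norm_real, Real.norm_of_nonneg (by positivity), ← mul_assoc,
          mul_comm δ⁻¹, mul_assoc, one_div, inv_mul_lt_iff₀ hn0, mul_one]
        exact hn
      obtain ⟨u, hu⟩ := surjective_add_of_norm_lt ih (inv_pos.2 hδ).le (hbelow _)
        (((1 / n : ℝ) : ℂ) • K) hB f
      refine ⟨u, ?_⟩
      rw [← hu, hT, hT, smul_apply, add_assoc, ← add_smul]
      congr 2
      push_cast
      ring
  have hT1 : ∀ u : A₀.domain, T 1 u = K u + A₀ u - lam • (u : H) := by
    intro u
    rw [hT, Complex.ofReal_one, one_smul]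
    abel
  refine mem_resolventSet_of_bound (C := δ⁻¹) (fun u => (hbelow 1 u).trans_eq ?_) fun f => ?_
  · exact congrArg (δ⁻¹ * ‖·‖) (hT1 u)
  · obtain ⟨u, hu⟩ := hsurj n f
    rw [div_self hn0.ne', hT1] at hu
    exact ⟨u, hu⟩

end Skew

/-- An operator on a Hilbert space is compact if it is arbitrarily small on the orthogonal complement
of a suitable finite-dimensional subspace. -/
theorem isCompactOperator_of_forall_small {H : Type*} [NormedAddCommGroup H]
    [InnerProductSpace ℂ H] [CompleteSpace H] {K : H →L[ℂ] H}
    (hK : ∀ ε > 0, ∃ S : Submodule ℂ H, FiniteDimensional ℂ S ∧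
      ∀ v ∈ Sᗮ, ‖K v‖ ≤ ε * ‖v‖) : IsCompactOperator K := by
  have hcl : IsClosed {T : H →L[ℂ] H | IsCompactOperator T} :=
    isClosed_setOfPred_isCompactOperator
  refine hcl.closure_subset_iff.2 Subset.rfl (Metric.mem_closure_iff.2 fun ε hε => ?_)
  obtain ⟨S, hfin, hS⟩ := hK (ε / 2) (half_pos hε)
  refine ⟨K ∘L S.starProjection, ?_, ?_⟩
  · have h1 : IsCompactOperator S.orthogonalProjectionOnto :=
      have := FiniteDimensional.proper ℂ S
      isCompactOperator_of_locallyCompactSpace_dom _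
    exact h1.clm_comp (K ∘L S.subtypeL)
  · rw [dist_eq_norm]
    refine (ContinuousLinearMap.opNorm_le_bound _ (half_pos hε).le fun v => ?_).trans_lt
      (half_lt_self hε)
    have h1 : (K - K ∘L S.starProjection) v = K (v - S.starProjection v) := by simp
    rw [h1]
    refine (hS _ (S.sub_starProjection_mem_orthogonal v)).trans ?_
    gcongr
    have h2 : v - S.starProjection v = Sᗮ.starProjection v := by
      rw [Submodule.starProjection_orthogonal_val]
    rw [h2]
    exact Sᗮ.norm_starProjection_apply_le v

/-! ### The antiderivative is bounded, skew-adjoint and compact -/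

/-- The indicator function of `(x, y]` as an element of `L²_per`. -/
noncomputable def intervalIndicator (x y : ℝ) : L2per :=
  indicatorConstLp 2 (measurableSet_Ioc (a := x) (b := y))
    (measure_ne_top (volume.restrict (Ioo (-Real.pi) Real.pi)) _) (1 : ℂ)

theorem integral_eq_inner (v : L2per) {x y : ℝ} (hx : -Real.pi ≤ x) (hxy : x ≤ y)
    (hy : y < Real.pi) : ∫ t in x..y, v t = inner ℂ (intervalIndicator x y) v := by
  have hsub : Ioc x y ⊆ Ioo (-Real.pi) Real.pi :=
    fun t ht => ⟨hx.trans_lt ht.1, ht.2.trans_lt hy⟩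
  rw [intervalIndicator, L2.inner_indicatorConstLp_one, Measure.restrict_restrict measurableSet_Ioc,
    inter_eq_left.2 hsub,
    intervalIntegral.integral_of_le hxy]

theorem norm_integral_le (v : L2per) {x y : ℝ} (hx : -Real.pi ≤ x) (hxy : x ≤ y)
    (hy : y < Real.pi) : ‖∫ t in x..y, v t‖ ≤ √(y - x) * ‖v‖ := by
  have hsub : Ioc x y ⊆ Ioo (-Real.pi) Real.pi :=
    fun t ht => ⟨hx.trans_lt ht.1, ht.2.trans_lt hy⟩
  rw [integral_eq_inner v hx hxy hy]
  refine (norm_inner_le_norm _ _).trans (mul_le_mul_of_nonneg_right ?_ (norm_nonneg _))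
  rw [intervalIndicator, norm_indicatorConstLp (by norm_num) (by norm_num), norm_one, one_mul,
    measureReal_restrict_apply measurableSet_Ioc,
    inter_eq_left.2 hsub,
    Real.volume_real_Ioc_of_le hxy, Real.sqrt_eq_rpow]
  simp

theorem isClosed_zeroMean : IsClosed (zeroMean : Set L2per) := by
  have h : (zeroMean : Set L2per) = {v | inner ℂ (intervalIndicator (-Real.pi) Real.pi) v = 0} := by
    ext v
    change ∫ z in Ioo (-Real.pi) Real.pi, v z = 0 ↔ _
    rw [mem_ofPred_eq, intervalIndicator, L2.inner_indicatorConstLp_one,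
      Measure.restrict_restrict measurableSet_Ioc, inter_eq_right.2 Ioo_subset_Ioc_self]
  rw [h]
  exact isClosed_eq (by fun_prop) continuous_const

instance : CompleteSpace L2dot := isClosed_zeroMean.completeSpace_coe

theorem coe_antiderivative (v : L2dot) :
    (antiderivative v : L2per) =ᵐ[volume.restrict (Ioo (-Real.pi) Real.pi)]
      zeroMeanPrimitive v :=
  MemLp.coeFn_toLp (memLp_zeroMeanPrimitive v)

theorem exists_norm_antiderivative_le : ∃ κ : ℝ, 0 < κ ∧ ∀ (v : L2dot) (M : ℝ), 0 ≤ M →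
    (∀ z ∈ Ioo (-Real.pi) Real.pi, ‖primitive v z‖ ≤ M) → ‖antiderivative v‖ ≤ κ * M := by
  set m := measureUnivNNReal (volume.restrict (Ioo (-Real.pi) Real.pi))
  refine ⟨(m : ℝ) ^ (2 : ENNReal).toReal⁻¹ * 2 + 1, by positivity, fun v M hM h => ?_⟩
  have hpi : 0 < 2 * Real.pi := by linarith [Real.pi_pos]
  have hmean : ‖∫ s in Ioo (-Real.pi) Real.pi, primitive v s‖ ≤ M * (2 * Real.pi) := by
    have := norm_setIntegral_le_of_norm_le_const (μ := volume)
      (measure_Ioo_lt_top (a := -Real.pi) (b := Real.pi)) h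
    rwa [Real.volume_real_Ioo_of_le neg_pi_le_pi,
      show Real.pi - -Real.pi = 2 * Real.pi by ring] at this
  have hae : ∀ᵐ z ∂volume.restrict (Ioo (-Real.pi) Real.pi),
      ‖(antiderivative v : L2per) z‖ ≤ 2 * M := by
    filter_upwards [coe_antiderivative v, ae_restrict_mem measurableSet_Ioo] with z hz hz'
    rw [hz, zeroMeanPrimitive]
    refine (norm_sub_le _ _).trans ?_
    rw [norm_mul, norm_inv, Complex.norm_real, Real.norm_of_nonneg hpi.le]
    have : (2 * Real.pi)⁻¹ * ‖∫ s in Ioo (-Real.pi) Real.pi, primitive v s‖ ≤ M := by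
      rw [inv_mul_le_iff₀ hpi]
      linarith
    linarith [h z hz']
  have := Lp.norm_le_of_ae_bound (by linarith) hae
  rw [add_mul, mul_assoc]
  exact this.trans (by linarith)

theorem exists_bound_antiderivative : ∃ C : ℝ, ∀ v : L2dot, ‖antiderivative v‖ ≤ C * ‖v‖ := by
  obtain ⟨κ, hκ, h⟩ := exists_norm_antiderivative_le
  refine ⟨κ * √(2 * Real.pi), fun v => ?_⟩
  rw [mul_assoc]
  refine h v _ (by positivity) fun z hz => ?_
  refine (norm_integral_le v le_rfl hz.1.le hz.2).trans
    (mul_le_mul_of_nonneg_right (Real.sqrt_le_sqrt ?_) (norm_nonneg _))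
  linarith [hz.2]

/-- The antiderivative as a bounded operator. -/
noncomputable def antiderivativeL : L2dot →L[ℂ] L2dot :=
  antiderivative.mkContinuous _ exists_bound_antiderivative.choose_spec

/-- The antiderivative is compact: if the primitive of `v` vanishes on a fine grid, which is
orthogonality of `v` to finitely many functions, then it is small everywhere. -/
theorem isCompactOperator_antiderivative : IsCompactOperator antiderivative := by
  obtain ⟨κ, hκ, hκb⟩ := exists_norm_antiderivative_le
  refine isCompactOperator_of_forall_small (K := antiderivativeL) fun ε hε => ?_
  have hpi := Real.pi_pos
  obtain ⟨N, hN⟩ := exists_nat_gt (2 * Real.pi / (ε / κ) ^ 2)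
  have hek : 0 < ε / κ := by positivity
  have hN0 : (0 : ℝ) < N := lt_of_le_of_lt (by positivity) hN
  set d : ℝ := 2 * Real.pi / N with hd
  have hd0 : 0 < d := by positivity
  have hsq : √d ≤ ε / κ := by
    rw [Real.sqrt_le_left hek.le, hd, div_le_iff₀ hN0]
    rw [div_lt_iff₀ (by positivity)] at hN
    linarith
  let b : Fin N → L2dot := fun i => (InnerProductSpace.toDual ℂ L2dot).symm
    ((innerSL ℂ (intervalIndicator (-Real.pi) (-Real.pi + i * d))).comp zeroMean.subtypeL)
  refine ⟨Submodule.span ℂ (range b), FiniteDimensional.span_of_finite ℂ (finite_range b),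
    fun v hv => ?_⟩
  have horth : ∀ i : Fin N,
      inner ℂ (intervalIndicator (-Real.pi) (-Real.pi + i * d)) (v : L2per) = 0 := by
    intro i
    have h1 : inner ℂ (b i) v = 0 :=
      (Submodule.mem_orthogonal _ _).1 hv _ (Submodule.subset_span (mem_range_self i))
    rwa [InnerProductSpace.toDual_symm_apply] at h1
  have hprim : ∀ z ∈ Ioo (-Real.pi) Real.pi, ‖primitive v z‖ ≤ √d * ‖v‖ := by
    intro z hz
    have hz0 : 0 ≤ (z + Real.pi) / d := div_nonneg (by linarith [hz.1]) hd0.le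
    set i := ⌊(z + Real.pi) / d⌋₊
    have h1 : (i : ℝ) * d ≤ z + Real.pi := by
      rw [← le_div_iff₀ hd0]
      exact Nat.floor_le hz0
    have h2 : z + Real.pi < (i + 1) * d := by
      rw [← div_lt_iff₀ hd0]
      exact Nat.lt_floor_add_one _
    have hiN : i < N := by
      have h3 : (i : ℝ) * d < N * d := by
        have : (N : ℝ) * d = 2 * Real.pi := by
          rw [hd]
          field_simp
        linarith [hz.2]
      exact_mod_cast lt_of_mul_lt_mul_right h3 hd0.le
    have hi0 : 0 ≤ (i : ℝ) * d := by positivity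
    have hzi : -Real.pi + i * d < Real.pi := by linarith [hz.2]
    have h4 : ∫ t in (-Real.pi)..(-Real.pi + i * d), (v : L2per) t = 0 := by
      rw [integral_eq_inner _ le_rfl (by linarith) hzi]
      exact horth ⟨i, hiN⟩
    have h5 : primitive v z = ∫ t in (-Real.pi + i * d)..z, (v : L2per) t := by
      have hIz := intervalIntegrable (v : L2per) hz
      have hsub : IntervalIntegrable (v : L2per) volume (-Real.pi) (-Real.pi + i * d) :=
        hIz.mono_set (by
          rw [uIcc_of_le hz.1.le, uIcc_of_le (by linarith)]
          exact Icc_subset_Icc_right (by linarith))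
      rw [primitive, ← intervalIntegral.integral_interval_sub_left hIz hsub, h4, sub_zero]
    rw [h5]
    refine (norm_integral_le _ (by linarith) (by linarith) hz.2).trans
      (mul_le_mul_of_nonneg_right (Real.sqrt_le_sqrt ?_) (norm_nonneg _))
    linarith
  refine (hκb v _ (by positivity) hprim).trans ?_
  calc κ * (√d * ‖v‖) ≤ κ * (ε / κ * ‖v‖) := by gcongr
    _ = ε * ‖v‖ := by field_simp

theorem integral_coe_eq_zero (v : L2dot) :
    ∫ z in Ioo (-Real.pi) Real.pi, (v : L2per) z = 0 := v.2

theorem inner_eq_integral (v w : L2dot) :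
    inner ℂ v w = ∫ z in Ioo (-Real.pi) Real.pi,
      (w : L2per) z * (starRingEnd ℂ) ((v : L2per) z) := by
  rw [Submodule.coe_inner, L2.inner_def]
  rfl

/-- The antiderivative of a periodic function with zero mean is skew-adjoint. -/
theorem re_inner_antiderivative (v : L2dot) : (inner ℂ v (antiderivative v)).re = 0 := by
  have hW : IsPrimitiveOn (zeroMeanPrimitive v) (v : L2per) (-Real.pi) Real.pi := by
    refine .of_eq_add neg_pi_le_pi (intervalIntegrable_cell_iff.2 (L2per.integrable v))
      fun x _ => ?_
    simp only [zeroMeanPrimitive, primitive, intervalIntegral.integral_same]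
    ring
  have hper : zeroMeanPrimitive v Real.pi = zeroMeanPrimitive v (-Real.pi) := by
    rw [hW.eq_add (right_mem_Icc.2 neg_pi_le_pi), ← integral_cell, integral_coe_eq_zero, add_zero]
  have h := (hW.mul neg_pi_le_pi hW.conj).2 _ (left_mem_Icc.2 neg_pi_le_pi) _
    (right_mem_Icc.2 neg_pi_le_pi)
  rw [hper, sub_self, ← integral_cell] at h
  have hI : IntegrableOn (fun z => zeroMeanPrimitive v z * (starRingEnd ℂ) ((v : L2per) z))
      (Ioo (-Real.pi) Real.pi) :=
    (memLp_zeroMeanPrimitive v).integrable_mul (Lp.memLp (v : L2per)).star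
  have hinner : inner ℂ v (antiderivative v) = ∫ z in Ioo (-Real.pi) Real.pi,
      zeroMeanPrimitive v z * (starRingEnd ℂ) ((v : L2per) z) := by
    rw [inner_eq_integral]
    refine integral_congr_ae ?_
    filter_upwards [coe_antiderivative v] with z hz
    rw [hz]
  have hI' : IntegrableOn (fun z => (v : L2per) z * (starRingEnd ℂ) (zeroMeanPrimitive v z))
      (Ioo (-Real.pi) Real.pi) :=
    (Lp.memLp (v : L2per)).integrable_mul (memLp_zeroMeanPrimitive v).star
  rw [integral_add hI' hI] at h
  have hc : ∫ z in Ioo (-Real.pi) Real.pi, (v : L2per) z * (starRingEnd ℂ) (zeroMeanPrimitive v z) =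
      (starRingEnd ℂ) (inner ℂ v (antiderivative v)) := by
    rw [hinner, ← integral_conj]
    refine integral_congr_ae (Eventually.of_forall fun z => ?_)
    simp [mul_comm]
  rw [hc, ← hinner, add_comm, Complex.add_conj] at h
  have h2 : 2 * (inner ℂ v (antiderivative v)).re = 0 := by exact_mod_cast h
  linarith

/-! ### The transport operator at the peaked wave -/

/-- A function in the domain of the transport operator has a representative `v` for which
`(c_* - U_*) v` is absolutely continuous. -/
theorem exists_rep_of_mem_domain (u : (transportOperator peakedSpeed peakedWave).domain) :
    ∃ G v : ℝ → ℂ, IsPrimitiveOn G (transportOperator peakedSpeed peakedWave u : L2per)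
      (-Real.pi) Real.pi ∧ (∀ z ∈ Ioo (-Real.pi) Real.pi, G z = speedGap z * v z) ∧
      v =ᵐ[volume.restrict (Ioo (-Real.pi) Real.pi)] ((u : L2dot) : L2per) := by
  have hw := transportOperator_spec peakedSpeed peakedWave u
  have hae : (fun z => ((peakedSpeed - peakedWave z : ℝ) : ℂ) * ((u : L2dot) : L2per) z)
      =ᵐ[volume.restrict (Ioo (-Real.pi) Real.pi)]
      fun z => (speedGap z : ℂ) * ((u : L2dot) : L2per) z := by
    filter_upwards [ae_restrict_mem measurableSet_Ioo] with z hz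
    rw [peakedSpeed_sub_peakedWave hz]
  have hL : MemLp (fun z => (speedGap z : ℂ) * ((u : L2dot) : L2per) z) 2
      (volume.restrict (Ioo (-Real.pi) Real.pi)) := by
    refine (Lp.memLp ((u : L2dot) : L2per)).of_le_mul (c := Real.pi ^ 2 / 6)
      ((Complex.continuous_ofReal.comp continuous_speedGap).aestronglyMeasurable.mul
        (Lp.aestronglyMeasurable _)) ?_
    filter_upwards [ae_restrict_mem measurableSet_Ioo] with z hz
    rw [norm_mul, Complex.norm_real, Real.norm_of_nonneg (speedGap_pos hz).le, speedGap]
    gcongr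
    linarith [sq_nonneg z]
  obtain ⟨G, hG, -, hGf⟩ := (hw.congr hae (EventuallyEq.refl _ _)).exists_isPrimitiveOn hL
  have hne : ∀ z ∈ Ioo (-Real.pi) Real.pi, (speedGap z : ℂ) ≠ 0 := fun z hz => by
    exact_mod_cast (speedGap_pos hz).ne'
  refine ⟨G, fun z => G z / speedGap z, hG, fun z hz => ?_, ?_⟩
  · rw [mul_div_cancel₀ _ (hne z hz)]
  · filter_upwards [hGf, ae_restrict_mem measurableSet_Ioo] with z h1 hz
    rw [← h1, mul_div_cancel_left₀ _ (hne z hz)]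

/-- The numerical range of the transport operator lies in the strip `|Re lam| ≤ π / 6`. -/
theorem abs_re_inner_transportOperator_le
    (u : (transportOperator peakedSpeed peakedWave).domain) :
    |(inner ℂ (u : L2dot) (transportOperator peakedSpeed peakedWave u)).re| ≤
      Real.pi / 6 * ‖(u : L2dot)‖ ^ 2 := by
  obtain ⟨G, v, hG, hv, hvu⟩ := exists_rep_of_mem_domain u
  set h : L2per := ((transportOperator peakedSpeed peakedWave u : L2dot) : L2per)
  have hvL : MemLp v 2 (volume.restrict (Ioo (-Real.pi) Real.pi)) :=
    (memLp_congr_ae hvu).2 (Lp.memLp _)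
  obtain ⟨-, -, -, -, -, hE⟩ := hG.exists_energy_extension hv (Lp.memLp h) hvL
  have i1 : IntegrableOn (fun z => h z * (starRingEnd ℂ) (v z)) (Ioo (-Real.pi) Real.pi) :=
    (Lp.memLp h).integrable_mul hvL.star
  have i1' : IntegrableOn (fun z => (h z * (starRingEnd ℂ) (v z)).re) (Ioo (-Real.pi) Real.pi) :=
    i1.re
  have i2 : IntegrableOn (fun z => ‖v z‖ ^ 2) (Ioo (-Real.pi) Real.pi) :=
    hvL.integrable_norm_pow (by norm_num)
  have hbd : ∀ᵐ z ∂volume.restrict (Ioo (-Real.pi) Real.pi), ‖z / 3‖ ≤ Real.pi / 3 := by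
    filter_upwards [ae_restrict_mem measurableSet_Ioo] with z hz
    rw [Real.norm_eq_abs, abs_le]
    constructor <;> linarith [hz.1, hz.2]
  have i3 : IntegrableOn (fun z => z / 3 * ‖v z‖ ^ 2) (Ioo (-Real.pi) Real.pi) :=
    Integrable.bdd_mul (c := Real.pi / 3) i2 (by fun_prop) hbd
  have hin : (inner ℂ (u : L2dot) (transportOperator peakedSpeed peakedWave u)).re =
      ∫ z in Ioo (-Real.pi) Real.pi, (h z * (starRingEnd ℂ) (v z)).re := by
    have e1 : inner ℂ (u : L2dot) (transportOperator peakedSpeed peakedWave u) =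
        ∫ z in Ioo (-Real.pi) Real.pi, h z * (starRingEnd ℂ) (v z) := by
      rw [inner_eq_integral]
      refine integral_congr_ae ?_
      filter_upwards [hvu] with z hz
      rw [hz]
    rw [e1]
    exact (integral_re i1).symm
  have hnorm : ‖(u : L2dot)‖ ^ 2 = ∫ z in Ioo (-Real.pi) Real.pi, ‖v z‖ ^ 2 := by
    have e1 : inner ℂ (u : L2dot) (u : L2dot) =
        ∫ z in Ioo (-Real.pi) Real.pi, ((‖v z‖ ^ 2 : ℝ) : ℂ) := by
      rw [inner_eq_integral]
      refine integral_congr_ae ?_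
      filter_upwards [hvu] with z hz
      rw [hz, Complex.mul_conj']
      push_cast
      rfl
    rw [norm_sq_eq_re_inner (𝕜 := ℂ), e1, integral_complex_ofReal]
    rfl
  rw [integral_add (i1'.const_mul 2) i3, integral_const_mul, ← hin] at hE
  have h3 : |∫ z in Ioo (-Real.pi) Real.pi, z / 3 * ‖v z‖ ^ 2| ≤
      Real.pi / 3 * ‖(u : L2dot)‖ ^ 2 := by
    rw [hnorm, ← integral_const_mul, ← Real.norm_eq_abs]
    refine norm_integral_le_of_norm_le (i2.const_mul _) ?_
    filter_upwards [hbd] with z hz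
    rw [norm_mul, norm_pow, norm_norm]
    gcongr
  rw [abs_le] at h3 ⊢
  constructor <;> linarith [h3.1, h3.2]

theorem exists_transportOperator_sub_eq {lam : ℂ} (hlam : Real.pi / 6 < |lam.re|) (f : L2dot) :
    ∃ u : (transportOperator peakedSpeed peakedWave).domain,
      transportOperator peakedSpeed peakedWave u - lam • (u : L2dot) = f := by
  obtain ⟨v, G, hvL, hG, hv⟩ := exists_transport_resolvent hlam (Lp.memLp (f : L2per))
  have hfL := Lp.memLp (f : L2per)
  obtain ⟨hl, hr⟩ := hG.eq_zero_of_sq_eq hv (hfL.add (hvL.const_mul lam)) hvL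
  have hlam0 : lam ≠ 0 := by
    rintro rfl
    simp only [Complex.zero_re, abs_zero] at hlam
    linarith [Real.pi_pos]
  -- `f + lam v` integrates to `G π - G (-π) = 0`, and `lam ≠ 0`.
  have hmean : ∫ z in Ioo (-Real.pi) Real.pi, v z = 0 := by
    have h := hG.2 _ (left_mem_Icc.2 neg_pi_le_pi) _ (right_mem_Icc.2 neg_pi_le_pi)
    rw [hl, hr, sub_self, ← integral_cell, integral_add (L2per.integrable f)
      ((hvL.integrable (by norm_num)).const_mul lam), integral_coe_eq_zero, zero_add,
      integral_const_mul] at h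
    exact (mul_eq_zero.1 h).resolve_left hlam0
  let u : L2dot := ⟨hvL.toLp v, by
    change ∫ z in Ioo (-Real.pi) Real.pi, _ = 0
    rw [integral_congr_ae hvL.coeFn_toLp, hmean]⟩
  have hu : (u : L2per) =ᵐ[volume.restrict (Ioo (-Real.pi) Real.pi)] v := hvL.coeFn_toLp
  have hmem : (u, f + lam • u) ∈ transportGraph peakedSpeed peakedWave := by
    refine (hG.hasPeriodicWeakDeriv (hl.trans hr.symm)).congr ?_ ?_
    · filter_upwards [hu, ae_restrict_mem measurableSet_Ioo] with z h1 hz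
      rw [hv z hz, peakedSpeed_sub_peakedWave hz, h1]
    · filter_upwards [hu, Lp.coeFn_add (f : L2per) ((lam • u : L2dot) : L2per),
        Lp.coeFn_smul lam (u : L2per)] with z h1 h2 h3
      change _ = ((f : L2per) + ((lam • u : L2dot) : L2per)) z
      rw [h2, Pi.add_apply]
      change _ = _ + (lam • (u : L2per)) z
      rw [h3, Pi.smul_apply, h1, smul_eq_mul]
  rw [← Submodule.toLinearPMap_graph_eq _ (transportGraph_functional peakedSpeed peakedWave),
    LinearPMap.mem_graph_iff] at hmem
  obtain ⟨w, hw1, hw2⟩ := hmem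
  refine ⟨w, ?_⟩
  have hw2' : transportOperator peakedSpeed peakedWave w = f + lam • u := hw2
  have hw1' : (w : L2dot) = u := hw1
  rw [hw2', hw1', add_sub_cancel_right]

/-- The resolvent equation of the transport operator, as an ordinary differential equation. -/
theorem exists_rep_of_sub_eq {lam : ℂ} {f : L2dot}
    {u : (transportOperator peakedSpeed peakedWave).domain}
    (hu : transportOperator peakedSpeed peakedWave u - lam • (u : L2dot) = f) :
    ∃ G v : ℝ → ℂ, MemLp v 2 (volume.restrict (Ioo (-Real.pi) Real.pi)) ∧
      IsPrimitiveOn G (fun z => (f : L2per) z + lam * v z) (-Real.pi) Real.pi ∧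
      (∀ z ∈ Ioo (-Real.pi) Real.pi, G z = speedGap z * v z) ∧
      v =ᵐ[volume.restrict (Ioo (-Real.pi) Real.pi)] ((u : L2dot) : L2per) := by
  obtain ⟨G, v, hG, hv, hvu⟩ := exists_rep_of_mem_domain u
  refine ⟨G, v, (memLp_congr_ae hvu).2 (Lp.memLp _), hG.congr_ae neg_pi_le_pi ?_, hv, hvu⟩
  have h1 : ((transportOperator peakedSpeed peakedWave u : L2dot) : L2per) =
      (f : L2per) + lam • ((u : L2dot) : L2per) := by
    rw [← hu]
    simp
  rw [h1]
  filter_upwards [hvu, Lp.coeFn_add (f : L2per) (lam • ((u : L2dot) : L2per)),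
    Lp.coeFn_smul lam ((u : L2dot) : L2per)] with z h2 h3 h4
  rw [h3, Pi.add_apply, h4, Pi.smul_apply, h2, smul_eq_mul]

theorem eq_zero_of_transportOperator_sub_eq_zero {lam : ℂ} (hlam : |lam.re| < Real.pi / 6)
    (u : (transportOperator peakedSpeed peakedWave).domain)
    (hu : transportOperator peakedSpeed peakedWave u - lam • (u : L2dot) = 0) :
    (u : L2dot) = 0 := by
  obtain ⟨G, v, hvL, hG, hv, hvu⟩ := exists_rep_of_sub_eq hu
  have h0 := Lp.coeFn_zero ℂ 2 (volume.restrict (Ioo (-Real.pi) Real.pi))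
  have hG' : IsPrimitiveOn G (fun z => lam * v z) (-Real.pi) Real.pi := by
    refine hG.congr_ae neg_pi_le_pi ?_
    filter_upwards [h0] with z hz
    change _ = (0 : L2per) z + _
    rw [hz, Pi.zero_apply, zero_add]
  have hz := hG'.eq_zero_of_eigen hlam hvL hv
  refine Subtype.ext (Lp.ext ?_)
  filter_upwards [h0, hvu, ae_restrict_mem measurableSet_Ioo] with z h1 h2 h3
  rw [← h2, hz z h3]
  exact h1.symm

theorem not_forall_exists_transportOperator_sub_eq {lam : ℂ} (hlam : |lam.re| < Real.pi / 6)
    (h0 : lam ≠ 0) :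
    ¬ ∀ f : L2dot, ∃ u : (transportOperator peakedSpeed peakedWave).domain,
      transportOperator peakedSpeed peakedWave u - lam • (u : L2dot) = f := by
  intro h
  obtain ⟨f, hfL, hf0, hfne⟩ := exists_integral_integratingFactor_mul_ne_zero hlam h0
  let F : L2dot := ⟨hfL.toLp f, by
    change ∫ z in Ioo (-Real.pi) Real.pi, _ = 0
    rw [integral_congr_ae hfL.coeFn_toLp, hf0]⟩
  have hF : (F : L2per) =ᵐ[volume.restrict (Ioo (-Real.pi) Real.pi)] f := hfL.coeFn_toLp
  obtain ⟨u, hu⟩ := h F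
  obtain ⟨G, v, hvL, hG, hv, -⟩ := exists_rep_of_sub_eq hu
  refine hfne ?_
  rw [← (hG.integratingFactor_mul hlam (Lp.memLp _) hvL hv).2]
  refine integral_congr_ae ?_
  filter_upwards [hF] with z hz
  rw [hz]

/-! ### The spectrum of the linearized operator -/

theorem mem_resolventSet_of_lt_abs_re {lam : ℂ} (hlam : Real.pi / 6 < |lam.re|) :
    lam ∈ resolventSet (linearizedOperator peakedSpeed peakedWave) :=
  mem_resolventSet_vadd_of_skew (K := antiderivativeL) re_inner_antiderivative
    abs_re_inner_transportOperator_le hlam (exists_transportOperator_sub_eq hlam)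

theorem notMem_resolventSet_of_abs_re_lt {lam : ℂ} (hlam : |lam.re| < Real.pi / 6)
    (h0 : lam ≠ 0) : lam ∉ resolventSet (linearizedOperator peakedSpeed peakedWave) := fun h =>
  not_forall_exists_transportOperator_sub_eq hlam h0
    (surjective_of_mem_resolventSet_vadd isCompactOperator_antiderivative h
      (eq_zero_of_transportOperator_sub_eq_zero hlam))

theorem notMem_resolventSet_of_abs_re_le {lam : ℂ} (hlam : |lam.re| ≤ Real.pi / 6) :
    lam ∉ resolventSet (linearizedOperator peakedSpeed peakedWave) := by
  intro h
  obtain ⟨r, hr, hball⟩ := Metric.isOpen_iff.1 (isOpen_resolventSet _) lam h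
  have hpi := Real.pi_pos
  -- Shrinking the real part and moving the imaginary part away from zero gives a nearby nonzero
  -- point of the open strip.
  obtain ⟨s, hs0, hs⟩ := exists_between (show 0 < min 1 (r / (Real.pi / 6 + 1)) by positivity)
  have hs1 : s < 1 := hs.trans_le (min_le_left _ _)
  have hsr : s * (Real.pi / 6 + 1) < r := by
    rw [← lt_div_iff₀ (by positivity)]
    exact hs.trans_le (min_le_right _ _)
  obtain ⟨e, he, hne⟩ : ∃ e : ℝ, |e| = s ∧ lam.im + e ≠ 0 := by
    rcases le_total 0 lam.im with hi | hi
    · exact ⟨s, abs_of_pos hs0, by linarith⟩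
    · exact ⟨-s, by rw [abs_neg, abs_of_pos hs0], by linarith⟩
  set mu : ℂ := ⟨(1 - s) * lam.re, lam.im + e⟩
  have hmu0 : mu ≠ 0 := fun h => hne (congrArg Complex.im h)
  have hmure : |mu.re| < Real.pi / 6 := by
    change |(1 - s) * lam.re| < _
    rw [abs_mul, abs_of_pos (by linarith : 0 < 1 - s)]
    nlinarith [abs_nonneg lam.re]
  refine notMem_resolventSet_of_abs_re_lt hmure hmu0 (hball ?_)
  rw [Metric.mem_ball, dist_eq_norm]
  refine (Complex.norm_le_abs_re_add_abs_im _).trans_lt ?_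
  have h1 : (mu - lam).re = -(s * lam.re) := by
    change (1 - s) * lam.re - lam.re = _
    ring
  have h2 : (mu - lam).im = e := by
    change lam.im + e - lam.im = _
    ring
  rw [h1, h2, abs_neg, abs_mul, abs_of_pos hs0, he]
  nlinarith [abs_nonneg lam.re]

theorem spectrum_linearizedOperator :
    spectrum (linearizedOperator peakedSpeed peakedWave) =
      {lam : ℂ | -(Real.pi / 6) ≤ lam.re ∧ lam.re ≤ Real.pi / 6} := by
  ext lam
  rw [mem_ofPred_eq, ← abs_le]
  refine ⟨fun h => ?_, notMem_resolventSet_of_abs_re_le⟩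
  by_contra! hlam
  exact h (mem_resolventSet_of_lt_abs_re hlam)

end Ostrovsky

theorem theorem2p1 :
    Ostrovsky.spectrum
        (Ostrovsky.linearizedOperator Ostrovsky.peakedSpeed Ostrovsky.peakedWave) =
      {lam : ℂ | -(Real.pi / 6) ≤ lam.re ∧ lam.re ≤ Real.pi / 6} ∧
    Ostrovsky.IsSpectrallyUnstable Ostrovsky.peakedSpeed Ostrovsky.peakedWave := by
  refine ⟨Ostrovsky.spectrum_linearizedOperator, fun h => ?_⟩
  have hpi := Real.pi_pos
  have hmem : ((Real.pi / 6 : ℝ) : ℂ) ∈ Ostrovsky.spectrum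
      (Ostrovsky.linearizedOperator Ostrovsky.peakedSpeed Ostrovsky.peakedWave) := by
    rw [Ostrovsky.spectrum_linearizedOperator]
    exact ⟨by rw [Complex.ofReal_re]; linarith, by rw [Complex.ofReal_re]⟩
  have h0 : ((Real.pi / 6 : ℝ) : ℂ).re = 0 := h hmem
  rw [Complex.ofReal_re] at h0
  linarith
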